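/- A \emph{cactus} is a finite connected simple graph in which any two distinct simple cycles have at most one vertex in common. Let $G=(V,E)$ be a graph and $s\in V$. In the \emph{multi-broadcasting model} with parameter $k$, initially only $s$ is informed, and in each round every informed vertex may inform up to $k$ of its uninformed neighbours (a vertex being informed by one call only); a \emph{valid scheme} is a finite sequence of such rounds after which all vertices are informed. The \emph{classic model} (Telephone Broadcasting) is the case $k=1$; let $\mathrm{OPT}(G,s)$ be the least number of rounds of a valid classic scheme. The algorithm \emph{Cactus Broadcaster} takes a cactus $G$ and a vertex $s$. It consists of two mutually recursive functions, which return schemes of the multi-broadcasting model with $k=2$, and of a conversion. (a) $\mathrm{single}(H,s)$, for a connected subgraph $H$ with informed vertex $s$: delete $s$ from $H$. For each component $C$ that contains exactly one neighbour $v$ of $s$, compute $\mathrm{single}(C,v)$; for each component $C$ that contains two neighbours $v,u$ of $s$, compute $\mathrm{double}(C,v,u)$. Sort the components by the number of rounds of these schemes in descending order; in round $i$ the vertex $s$ informs its one or two neighbours in the $i$-th component, where the computed scheme is followed from the next round on. (b) $\mathrm{double}(H,s_1,s_2)$, for a connected subgraph $H$ with informed vertices $s_1\neq s_2$ that are joined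 by a path $P$ of cut-edges of $H$: for each edge $e$ of $P$, the part of $H-e$ that contains $s_1$ is served from $s_1$ and the part that contains $s_2$ from $s_2$, in parallel, as $\mathrm{single}$ would do; the scheme with the fewest rounds over all $e$ is returned. For this, the schemes for the components of $H-V(P)$ are computed only once, by $\mathrm{single}$ or $\mathrm{double}$ from the one or two neighbours of the vertex of $P$ to which they are attached; then for each $e$ the schemes along $P$ are assembled from the ends of $e$ towards $s_1$ and $s_2$, treating the already assembled part of the path as one more component to be sorted. (c) The conversion with parameter $k$ replaces each round of a multi-broadcasting scheme by $k$ classic rounds, in the $j$-th of which every caller makes the $j$-th of its calls. Cactus Broadcaster applies it with $k=2$ to $\mathrm{single}(G,s)$ and returns the result. \textbf{Theorem.} \begin{enumerate} \item There is a polynomial $p$ such that for every cactus $G$ with $n$ vertices, given by its adjacency matrix, and every vertex $s$, Cactus Broadcaster takes at most $p(n)$ elementary steps (function calls including loop iterations, comparisons of vertices or numbers, adjacency probes). \item For every cactus $G$ and every vertex $s$, Cactus Broadcaster returns a valid classic scheme with at most $2\,\mathrm{OPT}(G,s)$ rounds. \item For every cactus $G$ and every vertex $s$, the scheme $\mathrm{single}(G,s)$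 is valid in the multi-broadcasting model with $k=2$, and it has at most $\mathrm{OPT}(G,s)$ rounds. \item For every finite graph $G$, every vertex $s$ and every $k$, the conversion turns each valid scheme with $r$ rounds of the multi-broadcasting model with parameter $k$ into a valid classic scheme with at most $kr$ rounds. \end{enumerate} -/

import Mathlib

namespace Telephone

/-! ### Cactus graphs -/

/-- A cactus is a connected graph in which any two different simple cycles have at most one vertex
in common. Two closed walks trace the same cycle when they have the same underlying subgraph. -/
def IsCactus {V : Type*} (G : SimpleGraph V) : Prop :=
  G.Connected ∧
    ∀ ⦃a b : V⦄ (c : G.Walk a a) (d : G.Walk b b), c.IsCycle → d.IsCycle →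
      c.toSubgraph ≠ d.toSubgraph → {v | v ∈ c.support ∧ v ∈ d.support}.Subsingleton

/-! ### Broadcasting schemes -/

/-- A call `(u, v)`: the vertex `u` informs the vertex `v`. -/
abbrev Call (V : Type*) := V × V

/-- A scheme lists, round after round, the calls that are made in that round. Its number of rounds
is its length. -/
abbrev Scheme (V : Type*) := List (List (Call V))

/-- `IsBroadcast k G I S`: if exactly the vertices in `I` are informed initially, then `S` is a valid
scheme of the multi-broadcasting model with parameter `k`, after which all vertices are informed.
In each round an informed vertex informs at most `k` of its uninformed neighbours, and a vertex is
informed by at most one call. The classic (telephone) model is the case `k = 1`. -/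
def IsBroadcast {V : Type*} [DecidableEq V] (k : ℕ) (G : SimpleGraph V) :
    Set V → Scheme V → Prop
  | I, [] => I = Set.univ
  | I, R :: S =>
      (∀ c ∈ R, G.Adj c.1 c.2 ∧ c.1 ∈ I ∧ c.2 ∉ I) ∧
      (R.map Prod.snd).Nodup ∧
      (∀ u, R.countP (fun c => decide (c.1 = u)) ≤ k) ∧
      IsBroadcast k G (I ∪ {v | v ∈ R.map Prod.snd}) S

/-- The least number of rounds of a valid scheme from the source `s` in the model with
parameter `k`. -/
noncomputable def broadcastTime {V : Type*} [DecidableEq V] (k : ℕ) (G : SimpleGraph V) (s : V) :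
    ℕ :=
  sInf {t | ∃ S : Scheme V, IsBroadcast k G {s} S ∧ S.length = t}

/-! ### The cost model

A computation returns a value together with the number of elementary steps that it took. The cost
model is the unit-cost one: one step for each call of each of the functions below (this pays for a
bounded number of constructions and inspections of list cells, pairs and options in its body), and
one further step for each comparison of two vertices, each probe of the adjacency matrix and each
comparison of two numbers. All loops are written as recursive functions, so that every iteration is
paid for. -/

/-- A value together with the number of steps spent on computing it. -/
structure Timed (α : Type) where
  /-- the result -/
  ret : α
  /-- the number of steps -/
  time : ℕ

instance : Monad Timed where
  pure a := ⟨a, 0⟩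
  bind x f := ⟨(f x.ret).ret, x.time + (f x.ret).time⟩

/-- One elementary step. -/
def tick : Timed Unit := ⟨(), 1⟩

/-- Compare two vertices. -/
def eqT {V : Type} [DecidableEq V] (u v : V) : Timed Bool := ⟨decide (u = v), 1⟩

/-- Probe the adjacency matrix. -/
def adjT {V : Type} (adj : V → V → Bool) (u v : V) : Timed Bool := ⟨adj u v, 1⟩

/-- Compare two numbers. -/
def leT (a b : ℕ) : Timed Bool := ⟨decide (a ≤ b), 1⟩

/-! ### Lists -/

/-- The length of a list. -/
def lengthT {α : Type} : List α → Timed ℕ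
  | [] => do tick; return 0
  | _ :: l => do
      tick
      let m ← lengthT l
      return m + 1

/-- Concatenation. -/
def appendT {α : Type} : List α → List α → Timed (List α)
  | [], l' => do tick; return l'
  | a :: l, l' => do
      tick
      let r ← appendT l l'
      return a :: r

/-- Reversal of the first list, followed by the second one. -/
def reverseT {α : Type} : List α → List α → Timed (List α)
  | [], acc => do tick; return acc
  | a :: l, acc => do
      tick
      reverseT l (a :: acc)

/-- The members that satisfy the test, and the other ones. -/
def partitionT {α : Type} (test : α → Timed Bool) : List α → Timed (List α × List α)
  | [] => do tick; return ([], [])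
  | a :: l => do
      tick
      let b ← test a
      let r ← partitionT test l
      if b then return (a :: r.1, r.2) else return (r.1, a :: r.2)

/-- Apply a function to all members and collect the results. -/
def mapT {α β : Type} (f : α → Timed β) : List α → Timed (List β)
  | [] => do tick; return []
  | a :: l => do
      tick
      let b ← f a
      let r ← mapT f l
      return b :: r

/-- Apply a partial function to all members and collect the results. -/
def filterMapT {α β : Type} (f : α → Timed (Option β)) : List α → Timed (List β)
  | [] => do tick; return []
  | a :: l => do
      tick
      let b ← f a
      let r ← filterMapT f l
      match b with
      | none => return r
      | some b => return b :: r

/-- Membership of a vertex. -/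
def memT {V : Type} [DecidableEq V] (v : V) : List V → Timed Bool
  | [] => do tick; return false
  | a :: l => do
      tick
      let b ← eqT v a
      if b then return true else memT v l

/-- The members of the first list that do not occur in the second one. -/
def diffT {V : Type} [DecidableEq V] (l l' : List V) : Timed (List V) := do
  tick
  let r ← partitionT (fun v => memT v l') l
  return r.2

/-! ### Searching the graph

A subgraph is given by the list of its vertices and stands for the subgraph induced on them. -/

/-- Graph search: `stack` holds discovered vertices, `rest` undiscovered ones. Returns the vertices
that are reachable from `stack`, and the members of `rest` that are not. The first argument bounds
the number of vertices that are taken from the stack. -/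
def exploreT {V : Type} (adj : V → V → Bool) :
    ℕ → List V → List V → Timed (List V × List V)
  | 0, _, rest => do tick; return ([], rest)
  | _ + 1, [], rest => do tick; return ([], rest)
  | f + 1, x :: stack, rest => do
      tick
      let r ← partitionT (adjT adj x) rest
      let stack' ← appendT r.1 stack
      let q ← exploreT adj f stack' r.2
      return (x :: q.1, q.2)

/-- The connected component of `v` in the subgraph on `v :: rest`, and the remaining vertices. -/
def componentT {V : Type} (adj : V → V → Bool) (v : V) (rest : List V) :
    Timed (List V × List V) := do
  tick
  let m ← lengthT rest
  exploreT adj (m + 1) [v] rest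

/-- The connected components of the subgraph on a list of vertices. The first argument bounds the
number of components. -/
def componentsAuxT {V : Type} (adj : V → V → Bool) : ℕ → List V → Timed (List (List V))
  | 0, _ => do tick; return []
  | _ + 1, [] => do tick; return []
  | f + 1, v :: rest => do
      tick
      let q ← componentT adj v rest
      let r ← componentsAuxT adj f q.2
      return q.1 :: r

/-- The connected components of the subgraph on a list of vertices. -/
def componentsT {V : Type} (adj : V → V → Bool) (U : List V) : Timed (List (List V)) := do
  tick
  let m ← lengthT U
  componentsAuxT adj m U

/-- A path from `v` to `u` in the subgraph on `v` and the vertices in `A`; here `v` is not in `A`.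
Its second vertex is a neighbour of `v` in the component of `u` that is left after `v` has been
deleted. The first argument bounds the number of edges. -/
def pathT {V : Type} [DecidableEq V] (adj : V → V → Bool) :
    ℕ → V → V → List V → Timed (List V)
  | 0, v, _, _ => do tick; return [v]
  | f + 1, v, u, A => do
      tick
      let b ← eqT v u
      if b then return [v] else
        let A' ← diffT A [u]
        let K ← componentT adj u A'
        let N ← partitionT (adjT adj v) K.1
        match N.1 with
        | [] => return [v]
        | w :: _ =>
            let K' ← diffT K.1 [w]
            let r ← pathT adj f w u K'
            return v :: r

/-! ### Cactus Broadcaster -/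

/-- What a vertex has to do for a component that it informs: the calls by which it informs its one
or two neighbours there (made in one round), and the scheme that is followed in the component
afterwards. The broadcasting time of the component is the length of that scheme. -/
abbrev Job (V : Type) := List (Call V) × Scheme V

/-- Follow two schemes in parallel. -/
def mergeT {V : Type} : Scheme V → Scheme V → Timed (Scheme V)
  | [], B => do tick; return B
  | a :: A, [] => do tick; return a :: A
  | a :: A, b :: B => do
      tick
      let c ← appendT a b
      let r ← mergeT A B
      return c :: r

/-- Insert a job into a list of jobs in descending order of broadcasting times. -/
def insertT {V : Type} (j : Job V) : List (Job V) → Timed (List (Job V))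
  | [] => do tick; return [j]
  | i :: l => do
      tick
      let a ← lengthT j.2
      let b ← lengthT i.2
      let c ← leT b a
      if c then return j :: i :: l else
        let r ← insertT j l
        return i :: r

/-- Sort jobs in descending order of broadcasting times. -/
def sortT {V : Type} : List (Job V) → Timed (List (Job V))
  | [] => do tick; return []
  | j :: l => do
      tick
      let r ← sortT l
      insertT j r

/-- Serve the jobs in the given order, opening one of them in each round; the scheme of a job runs
from the round after its opening on. So the number of rounds is the maximum of `(i + 1) + tᵢ`, where
`tᵢ` is the broadcasting time of the job with index `i` (counted from `0`). -/
def runJobsT {V : Type} : List (Job V) → Timed (Scheme V)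
  | [] => do tick; return []
  | j :: l => do
      tick
      let r ← runJobsT l
      let m ← mergeT j.2 r
      return j.1 :: m

/-- Serve jobs in descending order of broadcasting times. -/
def serveT {V : Type} (l : List (Job V)) : Timed (Scheme V) := do
  tick
  let r ← sortT l
  runJobsT r

/-- The job of the vertex `s` for a component `D`, given the two broadcasting functions for smaller
subgraphs: a call to its single neighbour in `D`, or a super call to its two neighbours in `D`.
In a cactus, no component contains more than two neighbours of `s`. -/
def componentJobT {V : Type} (adj : V → V → Bool)
    (single : List V → V → Timed (Scheme V)) (double : List V → V → V → Timed (Scheme V))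
    (s : V) (D : List V) : Timed (Option (Job V)) := do
  tick
  let N ← partitionT (adjT adj s) D
  match N.1 with
  | [v] =>
      let S ← single D v
      return some ([(s, v)], S)
  | [v, u] =>
      let S ← double D v u
      return some ([(s, v), (s, u)], S)
  | _ => return none

/-- The jobs of the vertex `s` for those components of the subgraph on `R` that contain a neighbour
of `s`. -/
def jobsT {V : Type} (adj : V → V → Bool)
    (single : List V → V → Timed (Scheme V)) (double : List V → V → V → Timed (Scheme V))
    (R : List V) (s : V) : Timed (List (Job V)) := do
  tick
  let Ds ← componentsT adj R
  filterMapT (componentJobT adj single double s) Ds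

/-- Broadcast along a path from its first vertex; every vertex of the path comes with its
(precomputed) jobs outside the path, to which the job of informing the next vertex of the path
is added. -/
def chainT {V : Type} : List (V × List (Job V)) → Timed (Scheme V)
  | [] => do tick; return []
  | [p] => do
      tick
      serveT p.2
  | p :: q :: l => do
      tick
      let acc ← chainT (q :: l)
      serveT (([(p.1, q.1)], acc) :: p.2)

/-- Try the edges of a path one after the other: `left` holds the vertices before the current edge
in reverse order, `right` those after it. When the edge is excluded, the first vertex of the path
broadcasts to the part before the edge, the last vertex to the part after it. The scheme with the
fewest rounds is kept (`none` if there is no edge). -/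
def bestSplitT {V : Type} : List (V × List (Job V)) → List (V × List (Job V)) →
    Timed (Option (Scheme V))
  | _, [] => do tick; return none
  | left, q :: right => do
      tick
      let l ← reverseT left []
      let r ← reverseT (q :: right) []
      let S₁ ← chainT l
      let S₂ ← chainT r
      let S ← mergeT S₁ S₂
      let best ← bestSplitT (q :: left) right
      match best with
      | none => return some S
      | some S' =>
          let a ← lengthT S
          let b ← lengthT S'
          let c ← leT a b
          if c then return some S else return some S'

mutual

/-- The single-source broadcaster: a scheme of the multi-broadcasting model for the subgraph on `U`
when its vertex `s` is informed. The vertex `s` is deleted, and the resulting components are served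
in descending order of their broadcasting times. The first argument bounds the depth of the
recursion. -/
def singleSourceT {V : Type} [DecidableEq V] (adj : V → V → Bool) :
    ℕ → List V → V → Timed (Scheme V)
  | 0, _, _ => do tick; return []
  | f + 1, U, s => do
      tick
      let R ← diffT U [s]
      let js ← jobsT adj (singleSourceT adj f) (doubleSourceT adj f) R s
      serveT js

/-- The double-source broadcaster: a scheme of the multi-broadcasting model for the subgraph on `U`
when its vertices `s₁` and `s₂` are informed, which are joined by a path of cut-edges. The
components that are left after the deletion of the path are treated once, and then for each edge of
the path the scheme that excludes this edge is assembled; the best one is returned. -/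
def doubleSourceT {V : Type} [DecidableEq V] (adj : V → V → Bool) :
    ℕ → List V → V → V → Timed (Scheme V)
  | 0, _, _, _ => do tick; return []
  | f + 1, U, s₁, s₂ => do
      tick
      let m ← lengthT U
      let A ← diffT U [s₁]
      let P ← pathT adj m s₁ s₂ A
      let R ← diffT U P
      let arms ← mapT (fun p => do
        tick
        let js ← jobsT adj (singleSourceT adj f) (doubleSourceT adj f) R p
        return (p, js)) P
      match arms with
      | [] => return []
      | p :: l =>
          let best ← bestSplitT [p] l
          match best with
          | none => return []
          | some S => return S

end

/-- Split the calls of a round into the first call of each caller and the remaining calls; `seen`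
holds the callers met before. -/
def firstCallsT {V : Type} [DecidableEq V] : List V → List (Call V) →
    Timed (List (Call V) × List (Call V))
  | _, [] => do tick; return ([], [])
  | seen, c :: R => do
      tick
      let b ← memT c.1 seen
      if b then
        let r ← firstCallsT seen R
        return (r.1, c :: r.2)
      else
        let r ← firstCallsT (c.1 :: seen) R
        return (c :: r.1, r.2)

/-- Replace a round by `k` rounds: the `j`-th call of each caller is made in the `j`-th of them. -/
def splitRoundT {V : Type} [DecidableEq V] : ℕ → List (Call V) → Timed (Scheme V)
  | 0, _ => do tick; return []
  | k + 1, R => do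
      tick
      let r ← firstCallsT [] R
      let S ← splitRoundT k r.2
      return r.1 :: S

/-- Convert a scheme of the multi-broadcasting model with parameter `k` to the classic model. -/
def toClassicT {V : Type} [DecidableEq V] (k : ℕ) : Scheme V → Timed (Scheme V)
  | [] => do tick; return []
  | R :: S => do
      tick
      let A ← splitRoundT k R
      let B ← toClassicT k S
      appendT A B

/-- The multi-broadcasting part (`k = 2`) of Cactus Broadcaster. The input graph is given by its
vertices `0, …, n - 1` and its adjacency matrix. -/
def superScheme {n : ℕ} (G : SimpleGraph (Fin n)) [DecidableRel G.Adj] (s : Fin n) :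
    Timed (Scheme (Fin n)) := do
  tick
  singleSourceT (fun u v => decide (G.Adj u v)) n (List.finRange n) s

/-- Cactus Broadcaster: compute a scheme of the multi-broadcasting model and convert it to the
classic model. -/
def cactusBroadcaster {n : ℕ} (G : SimpleGraph (Fin n)) [DecidableRel G.Adj] (s : Fin n) :
    Timed (Scheme (Fin n)) := do
  tick
  let S ← superScheme G s
  toClassicT 2 S

end Telephone

namespace Telephone

/-! ### Values and costs of the list functions -/

namespace Timed

variable {α β : Type}

-- Classic schemes enter the optimality proof only through the relaxation `Feasible`: every vertex
-- not informed at the start has an informer `π` and a time `τ`, times increase along informers, and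
-- vertices with the same informer have different times. Unlike a list of rounds, this datum
-- restricts easily to parts of the graph. The invariant `Solves` says that a scheme with super
-- calls is valid on a part and takes at most `r` rounds whenever `r` is feasible there from the
-- same informed vertices.
--
-- Single source: in a classic broadcast with `r` rounds, the earliest vertex of each component of
-- `H - s` is called by `s` itself, at a time `t`, and these times are distinct. The component then
-- has `r - t` rounds left, and assuming that all neighbours of `s` in it are already informed only
-- helps, so its computed scheme has at most `r - t` rounds (`AreJobs.exists_opening`). By
-- pigeonhole, opening the components in descending order of broadcasting times stays within `r`
-- (`runJobsT_length_le_of_injOn`).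
--
-- Double source: two different cycles of a cactus cannot share an edge. Hence a component contains
-- at most two neighbours of a deleted vertex (`IsCactus.eq_of_adj`), and if there are two, each
-- edge of a path between them inside the component separates them there (`IsCactus.isArms`). A
-- classic broadcast from both ends leaves some edge of this path unused (`exists_unused_edge`), so
-- it splits into two single-source broadcasts. For each excluded edge the chains on the two sides
-- are optimal, since the rest of a path is one more job of its first vertex
-- (`IsArms.solves_chainT`); trying all edges includes the unused one.
--
-- Cost: `Computes` charges a polynomial amount `K` to each call of the produced scheme, plus one
-- more `K` for the current invocation. The additional `K` of a recursive invocation is paid by the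
-- call that opens its component. The called vertices are distinct, so there are at most `n` calls.
--
-- Finally, the conversion turns the bound of one optimum for super calls into two optima for
-- classic calls, and it also shows that a classic scheme exists at all.

@[simp] theorem bind_ret (x : Timed α) (f : α → Timed β) : (x >>= f).ret = (f x.ret).ret := rfl

@[simp] theorem bind_time (x : Timed α) (f : α → Timed β) :
    (x >>= f).time = x.time + (f x.ret).time := rfl

@[simp] theorem pure_ret (a : α) : (pure a : Timed α).ret = a := rfl

@[simp] theorem pure_time (a : α) : (pure a : Timed α).time = 0 := rfl

end Timed

@[simp] theorem tick_time : tick.time = 1 := rfl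

section Lists

variable {α β : Type} {V : Type} [DecidableEq V]

@[simp] theorem eqT_ret (u v : V) : (eqT u v).ret = decide (u = v) := rfl
@[simp] theorem eqT_time (u v : V) : (eqT u v).time = 1 := rfl
@[simp] theorem adjT_ret {V : Type} (adj : V → V → Bool) (u v : V) :
    (adjT adj u v).ret = adj u v := rfl
@[simp] theorem leT_ret (a b : ℕ) : (leT a b).ret = decide (a ≤ b) := rfl
@[simp] theorem leT_time (a b : ℕ) : (leT a b).time = 1 := rfl

@[simp] theorem lengthT_ret (l : List α) : (lengthT l).ret = l.length := by
  induction l with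
  | nil => simp [lengthT]
  | cons a l ih => simp [lengthT, ih]

@[simp] theorem lengthT_time (l : List α) : (lengthT l).time = l.length + 1 := by
  induction l with
  | nil => simp [lengthT]
  | cons a l ih => simp [lengthT, ih]; omega

@[simp] theorem appendT_ret (l l' : List α) : (appendT l l').ret = l ++ l' := by
  induction l with
  | nil => simp [appendT]
  | cons a l ih => simp [appendT, ih]

@[simp] theorem appendT_time (l l' : List α) : (appendT l l').time = l.length + 1 := by
  induction l with
  | nil => simp [appendT]
  | cons a l ih => simp [appendT, ih]; omega

@[simp] theorem reverseT_ret (l acc : List α) : (reverseT l acc).ret = l.reverse ++ acc := by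
  induction l generalizing acc with
  | nil => simp [reverseT]
  | cons a l ih => simp [reverseT, ih]

@[simp] theorem reverseT_time (l acc : List α) : (reverseT l acc).time = l.length + 1 := by
  induction l generalizing acc with
  | nil => simp [reverseT]
  | cons a l ih => simp [reverseT, ih]; omega

@[simp] theorem partitionT_ret (test : α → Timed Bool) (l : List α) :
    (partitionT test l).ret =
      (l.filter fun a => (test a).ret, l.filter fun a => !(test a).ret) := by
  induction l with
  | nil => simp [partitionT]
  | cons a l ih =>
      simp only [partitionT, Timed.bind_ret, ih]
      cases h : (test a).ret <;> simp [h]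

theorem partitionT_time_le (test : α → Timed Bool) (c : ℕ) (l : List α)
    (h : ∀ a ∈ l, (test a).time ≤ c) :
    (partitionT test l).time ≤ l.length * (c + 1) + 1 := by
  induction l with
  | nil => simp [partitionT]
  | cons a l ih =>
      have h₁ := h a (by simp)
      have h₂ := ih fun b hb => h b (by simp [hb])
      simp only [partitionT, Timed.bind_time, tick_time, List.length_cons]
      split <;> simp only [Timed.pure_time] <;> linarith

@[simp] theorem mapT_ret (f : α → Timed β) (l : List α) :
    (mapT f l).ret = l.map fun a => (f a).ret := by
  induction l with
  | nil => simp [mapT]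
  | cons a l ih => simp [mapT, ih]

theorem mapT_time (f : α → Timed β) (l : List α) :
    (mapT f l).time = (l.map fun a => (f a).time).sum + l.length + 1 := by
  induction l with
  | nil => simp [mapT]
  | cons a l ih => simp [mapT, ih]; omega

@[simp] theorem filterMapT_ret (f : α → Timed (Option β)) (l : List α) :
    (filterMapT f l).ret = l.filterMap fun a => (f a).ret := by
  induction l with
  | nil => simp [filterMapT]
  | cons a l ih =>
      simp only [filterMapT, Timed.bind_ret, ih]
      cases h : (f a).ret <;> simp [h]

theorem filterMapT_time (f : α → Timed (Option β)) (l : List α) :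
    (filterMapT f l).time = (l.map fun a => (f a).time).sum + l.length + 1 := by
  induction l with
  | nil => simp [filterMapT]
  | cons a l ih =>
      simp only [filterMapT, Timed.bind_time, ih, tick_time, List.map_cons, List.sum_cons,
        List.length_cons]
      cases h : (f a).ret <;> simp only [Timed.pure_time] <;> omega

@[simp] theorem memT_ret (v : V) (l : List V) : (memT v l).ret = decide (v ∈ l) := by
  induction l with
  | nil => simp [memT]
  | cons a l ih =>
      simp only [memT, Timed.bind_ret, eqT_ret]
      by_cases h : v = a <;> simp [h, ih]

theorem memT_time_le (v : V) (l : List V) : (memT v l).time ≤ 2 * l.length + 1 := by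
  induction l with
  | nil => simp [memT]
  | cons a l ih =>
      simp only [memT, Timed.bind_time, eqT_ret, eqT_time, tick_time, List.length_cons]
      by_cases h : v = a <;> simp [h] <;> omega

@[simp] theorem diffT_ret (l l' : List V) : (diffT l l').ret = l.filter fun v => v ∉ l' := by
  simp [diffT]

theorem diffT_time_le (l l' : List V) :
    (diffT l l').time ≤ l.length * (2 * l'.length + 2) + 2 := by
  have := partitionT_time_le (fun v => memT v l') (2 * l'.length + 1) l
    fun v _ => memT_time_le v l'
  simp only [diffT, Timed.bind_time, tick_time, Timed.pure_time]
  linarith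

end Lists


/-! ### Conversion to the classic model -/

section Conversion

variable {V : Type} [DecidableEq V]

theorem firstCallsT_perm (seen : List V) (R : List (Call V)) :
    ((firstCallsT seen R).ret.1 ++ (firstCallsT seen R).ret.2).Perm R := by
  induction R generalizing seen with
  | nil => simp [firstCallsT]
  | cons c R ih =>
      simp only [firstCallsT, Timed.bind_ret, memT_ret]
      by_cases h : c.1 ∈ seen
      · simpa [h] using List.perm_middle.trans ((ih seen).cons c)
      · simpa [h] using ih (c.1 :: seen)

theorem firstCallsT_callers (seen : List V) (R : List (Call V)) :
    ((firstCallsT seen R).ret.1.map Prod.fst).Nodup ∧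
      ∀ c ∈ (firstCallsT seen R).ret.1, c.1 ∉ seen := by
  induction R generalizing seen with
  | nil => simp [firstCallsT]
  | cons c R ih =>
      simp only [firstCallsT, Timed.bind_ret, memT_ret]
      by_cases h : c.1 ∈ seen
      · simpa [h] using ih seen
      · obtain ⟨h₁, h₂⟩ := ih (c.1 :: seen)
        simp only [h, decide_false, Bool.false_eq_true, if_false, Timed.bind_ret, Timed.pure_ret,
          List.map_cons, List.nodup_cons, List.mem_cons, forall_eq_or_imp, not_false_eq_true,
          true_and]
        refine ⟨⟨fun hc => ?_, h₁⟩, fun d hd hs => h₂ d hd (by simp [hs])⟩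
        obtain ⟨d, hd, hdc⟩ := List.mem_map.1 hc
        exact h₂ d hd (by simp [hdc])

/-- This makes the induction on `k` in the conversion work: with `seen` empty, each caller that
occurs has exactly one call fewer left. Truncated subtraction covers vertices without calls. -/
theorem firstCallsT_countP (seen : List V) (R : List (Call V)) (u : V) :
    (firstCallsT seen R).ret.2.countP (fun c => decide (c.1 = u)) =
      R.countP (fun c => decide (c.1 = u)) - if u ∈ seen then 0 else 1 := by
  induction R generalizing seen with
  | nil => simp [firstCallsT]
  | cons c R ih =>
      simp only [firstCallsT, Timed.bind_ret, memT_ret]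
      by_cases h : c.1 ∈ seen
      · simp only [h, decide_true, if_true, Timed.bind_ret, Timed.pure_ret, List.countP_cons, ih]
        by_cases hu : c.1 = u
        · have : u ∈ seen := hu ▸ h
          simp [hu, this]
        · simp [hu]
      · simp only [h, decide_false, Bool.false_eq_true, if_false, Timed.bind_ret, Timed.pure_ret,
          List.countP_cons, ih]
        by_cases hu : c.1 = u
        · have : u ∉ seen := hu ▸ h
          simp [hu, this]
        · simp [hu, Ne.symm hu]

theorem firstCallsT_time_le (seen : List V) (R : List (Call V)) :
    (firstCallsT seen R).time ≤ R.length * (2 * (seen.length + R.length) + 2) + 1 := by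
  induction R generalizing seen with
  | nil => simp [firstCallsT]
  | cons c R ih =>
      have hm := memT_time_le c.1 seen
      simp only [firstCallsT, Timed.bind_time, memT_ret, tick_time, List.length_cons]
      by_cases h : c.1 ∈ seen
      · have := ih seen
        simp only [h, decide_true, if_true, Timed.bind_time, Timed.pure_time]
        nlinarith
      · have := ih (c.1 :: seen)
        simp only [List.length_cons] at this
        simp only [h, decide_false, Bool.false_eq_true, if_false, Timed.bind_time, Timed.pure_time]
        nlinarith

theorem splitRoundT_length (k : ℕ) (R : List (Call V)) :
    (splitRoundT k R).ret.length = k := by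
  induction k generalizing R with
  | zero => simp [splitRoundT]
  | succ k ih => simp [splitRoundT, ih]

theorem splitRoundT_time_le (k : ℕ) (R : List (Call V)) {n : ℕ} (h : R.length ≤ n) :
    (splitRoundT k R).time ≤ k * (n * (2 * n + 2) + 2) + 1 := by
  induction k generalizing R with
  | zero => simp [splitRoundT]
  | succ k ih =>
      have hp := (firstCallsT_perm [] R).length_eq
      rw [List.length_append] at hp
      have h₁ := ih (firstCallsT [] R).ret.2 (by omega)
      have h₂ := firstCallsT_time_le [] R
      have h₃ : R.length * (2 * (0 + R.length) + 2) ≤ n * (2 * n + 2) := by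
        rw [Nat.zero_add]; gcongr
      simp only [List.length_nil] at h₂
      simp only [splitRoundT, Timed.bind_time, tick_time, Timed.pure_time]
      linarith

theorem toClassicT_length (k : ℕ) (S : Scheme V) :
    (toClassicT k S).ret.length = k * S.length := by
  induction S with
  | nil => simp [toClassicT]
  | cons R S ih => simp [toClassicT, ih, splitRoundT_length]; ring

theorem toClassicT_time_le (k : ℕ) (S : Scheme V) {n : ℕ} (h : ∀ R ∈ S, R.length ≤ n) :
    (toClassicT k S).time ≤ S.length * (k * (n * (2 * n + 2) + 3) + 3) + 1 := by
  induction S with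
  | nil => simp [toClassicT]
  | cons R S ih =>
      have h₁ := splitRoundT_time_le k R (h R (by simp))
      have h₂ := ih fun Q hQ => h Q (by simp [hQ])
      simp only [toClassicT, Timed.bind_time, tick_time, appendT_time, splitRoundT_length,
        List.length_cons]
      linarith

/-- The callees of a round are distinct, so a postponed call still reaches an uninformed vertex,
while its caller remains informed. The tail `B` is carried along because validity is stated for the
scheme up to its end. -/
theorem isBroadcast_splitRoundT_append {G : SimpleGraph V} (k : ℕ) (R : List (Call V)) (I : Set V)
    (B : Scheme V) (hR : ∀ c ∈ R, G.Adj c.1 c.2 ∧ c.1 ∈ I ∧ c.2 ∉ I)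
    (hn : (R.map Prod.snd).Nodup) (hk : ∀ u, R.countP (fun c => decide (c.1 = u)) ≤ k)
    (hB : IsBroadcast 1 G (I ∪ {v | v ∈ R.map Prod.snd}) B) :
    IsBroadcast 1 G I ((splitRoundT k R).ret ++ B) := by
  induction k generalizing R I with
  | zero =>
      have : R = [] := by
        cases R with
        | nil => rfl
        | cons c R => simpa using hk c.1
      subst this
      simpa [splitRoundT] using hB
  | succ k ih =>
      have hp := firstCallsT_perm [] R
      have hc := (firstCallsT_callers [] R).1
      have hcount := firstCallsT_countP [] R
      simp only [splitRoundT, Timed.bind_ret, Timed.pure_ret, List.cons_append]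
      generalize (firstCallsT [] R).ret = r at *
      have hn' := ((hp.map Prod.snd).nodup_iff).2 hn
      rw [List.map_append, List.nodup_append] at hn'
      obtain ⟨hn₁, hn₂, hd⟩ := hn'
      refine ⟨fun c h => hR c (hp.subset (by simp [h])), hn₁, fun u => ?_, ?_⟩
      · have hu := List.nodup_iff_count_le_one.1 hc u
        rw [List.count, List.countP_map] at hu
        exact hu
      · refine ih r.2 _ (fun c h => ?_) hn₂ (fun u => ?_) ?_
        · obtain ⟨h₁, h₂, h₃⟩ := hR c (hp.subset (by simp [h]))
          refine ⟨h₁, Or.inl h₂, ?_⟩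
          rintro (h₄ | h₄)
          · exact h₃ h₄
          · exact hd _ h₄ _ (List.mem_map_of_mem h) rfl
        · have := hk u
          rw [hcount u]
          simp only [List.not_mem_nil, if_false]
          omega
        · convert hB using 1
          ext v
          have := (hp.map Prod.snd).mem_iff (a := v)
          rw [List.map_append, List.mem_append] at this
          simp only [Set.mem_union, Set.mem_ofPred_eq, ← this, or_assoc]

/-- The conversion turns schemes of the multi-broadcasting model into classic ones. -/
theorem IsBroadcast.toClassicT {G : SimpleGraph V} {k : ℕ} {I : Set V} {S : Scheme V}
    (h : IsBroadcast k G I S) : IsBroadcast 1 G I (toClassicT k S).ret := by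
  induction S generalizing I with
  | nil => simpa [Telephone.toClassicT, IsBroadcast] using h
  | cons R S ih =>
      obtain ⟨h₁, h₂, h₃, h₄⟩ := h
      simpa [Telephone.toClassicT] using isBroadcast_splitRoundT_append k R I _ h₁ h₂ h₃ (ih h₄)

end Conversion

/-! ### Timed broadcasting forests -/

section Forest

variable {V : Type}

/-- The vertices in `U` can be informed in the classic model within `r` rounds when those in `I` are
informed at the beginning: `π v` is the vertex that informs `v`, and `τ v` the round in which this
happens. -/
def Feasible (G : SimpleGraph V) (U I : Set V) (r : ℕ) : Prop :=
  ∃ (τ : V → ℕ) (π : V → V),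
    (∀ v ∈ U, v ∉ I → π v ∈ U ∧ G.Adj (π v) v ∧ τ (π v) < τ v ∧ τ v ≤ r) ∧
    ∀ v ∈ U, v ∉ I → ∀ w ∈ U, w ∉ I → π v = π w → τ v = τ w → v = w

/-- This is the only passage from classic schemes to the relaxation; everything about optimality is
proved for `Feasible`. -/
theorem IsBroadcast.feasible [DecidableEq V] {G : SimpleGraph V} {I : Set V} {S : Scheme V}
    (h : IsBroadcast 1 G I S) : Feasible G Set.univ I S.length := by
  classical
  induction S generalizing I with
  | nil =>
      have : I = Set.univ := h
      exact ⟨fun _ => 0, id, by simp [this], by simp [this]⟩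
  | cons R S ih =>
      obtain ⟨hR, -, hk, hS⟩ := h
      obtain ⟨τ, π, h₁, h₂⟩ := ih hS
      have hex : ∀ v, ∃ u, v ∈ R.map Prod.snd → (u, v) ∈ R := by
        intro v
        by_cases hv : v ∈ R.map Prod.snd
        · obtain ⟨c, hc, rfl⟩ := List.mem_map.1 hv
          exact ⟨c.1, fun _ => hc⟩
        · exact ⟨v, fun h => absurd h hv⟩
      choose ρ hρ using hex
      have hinj : ∀ u v w, (u, v) ∈ R → (u, w) ∈ R → v = w := by
        intro u v w hv hw
        by_contra hne
        have h2 : [(u, v), (u, w)].Subperm R :=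
          List.Nodup.subperm (by simp [hne]) (by simp [hv, hw])
        have h3 := (h2.countP_le (fun c => decide (c.1 = u))).trans (hk u)
        simp at h3
      have hdisj : ∀ v ∈ R.map Prod.snd, v ∉ I := by
        intro v hv
        exact (hR _ (hρ v hv)).2.2
      -- The sources get time 0, the callees of the first round time 1, and the times of the
      -- remaining scheme are shifted by one.
      refine ⟨fun v => if v ∈ I then 0 else if v ∈ R.map Prod.snd then 1 else τ v + 1,
        fun v => if v ∈ R.map Prod.snd then ρ v else π v, ?_, ?_⟩
      · intro v _ hv
        by_cases hvR : v ∈ R.map Prod.snd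
        · obtain ⟨ha, hi, -⟩ := hR _ (hρ v hvR)
          simp only [hvR, if_true, hv, if_false]
          simp only at ha hi
          simp [ha, hi]
        · obtain ⟨-, ha, hlt, hle⟩ := h₁ v trivial (by
            simp only [Set.mem_union, not_or]; exact ⟨hv, hvR⟩)
          simp only [hvR, hv, if_false, List.length_cons]
          refine ⟨trivial, ha, ?_, by omega⟩
          split_ifs <;> omega
      · intro v _ hv w _ hw hπ hτ
        simp only [hv, hw, if_false] at hτ
        by_cases hvR : v ∈ R.map Prod.snd <;> by_cases hwR : w ∈ R.map Prod.snd <;>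
          simp only [hvR, hwR, if_true, if_false] at hπ hτ
        · exact hinj _ _ _ (hρ v hvR) (hπ ▸ hρ w hwR)
        -- A vertex called later has positive time in the remaining scheme, hence shifted time at
        -- least 2; it cannot clash with a call of the first round.
        · have := (h₁ w trivial (by simp only [Set.mem_union, not_or]; exact ⟨hw, hwR⟩)).2.2.1
          omega
        · have := (h₁ v trivial (by simp only [Set.mem_union, not_or]; exact ⟨hv, hvR⟩)).2.2.1
          omega
        · exact h₂ v trivial (by simp only [Set.mem_union, not_or]; exact ⟨hv, hvR⟩) w trivial
            (by simp only [Set.mem_union, not_or]; exact ⟨hw, hwR⟩) hπ (by omega)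

end Forest


/-! ### Schemes on a part of the graph -/

section Schemes

variable {V : Type}

/-- The vertices that are called in a scheme. -/
def called (S : Scheme V) : List V := S.flatten.map Prod.snd

@[simp] theorem called_nil : called ([] : Scheme V) = [] := rfl

@[simp] theorem called_cons (R : List (Call V)) (S : Scheme V) :
    called (R :: S) = R.map Prod.snd ++ called S := by
  simp [called]

theorem length_called (S : Scheme V) : (called S).length = S.flatten.length := by
  rw [called, List.length_map]

@[simp] theorem mergeT_nil_left (B : Scheme V) : (mergeT [] B).ret = B := by
  simp [mergeT]

@[simp] theorem mergeT_nil_right (A : Scheme V) : (mergeT A []).ret = A := by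
  cases A <;> simp [mergeT]

@[simp] theorem mergeT_cons_cons (a b : List (Call V)) (A B : Scheme V) :
    (mergeT (a :: A) (b :: B)).ret = (a ++ b) :: (mergeT A B).ret := by
  simp [mergeT]

theorem mergeT_length (A B : Scheme V) :
    (mergeT A B).ret.length = max A.length B.length := by
  induction A generalizing B with
  | nil => simp
  | cons a A ih =>
      cases B with
      | nil => simp
      | cons b B => simp [ih]

theorem mergeT_flatten_length (A B : Scheme V) :
    (mergeT A B).ret.flatten.length = A.flatten.length + B.flatten.length := by
  induction A generalizing B with
  | nil => simp
  | cons a A ih =>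
      cases B with
      | nil => simp
      | cons b B =>
          have := ih B
          simp only [mergeT_cons_cons, List.flatten_cons, List.length_append] at *
          omega

theorem mergeT_time_le (A B : Scheme V) :
    (mergeT A B).time ≤ 2 * A.length + A.flatten.length + 1 := by
  induction A generalizing B with
  | nil => simp [mergeT]
  | cons a A ih =>
      cases B with
      | nil => simp [mergeT]
      | cons b B =>
          have := ih B
          simp only [mergeT, Timed.bind_time, tick_time, appendT_time, Timed.pure_time,
            List.flatten_cons, List.length_append, List.length_cons]
          omega

variable [DecidableEq V]

/-- `S` is a scheme with super calls (at most two calls per vertex and round) for the subgraph on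
`U` when the vertices in `I` are informed. -/
def ValidOn (G : SimpleGraph V) (U : Set V) : Set V → Scheme V → Prop
  | I, [] => U ⊆ I
  | I, R :: S =>
      (∀ c ∈ R, G.Adj c.1 c.2 ∧ c.1 ∈ I ∧ c.2 ∉ I ∧ c.2 ∈ U) ∧
      (R.map Prod.snd).Nodup ∧
      (∀ u, R.countP (fun c => decide (c.1 = u)) ≤ 2) ∧
      ValidOn G U (I ∪ {v | v ∈ R.map Prod.snd}) S

variable {G : SimpleGraph V}

theorem ValidOn.isBroadcast {I : Set V} {S : Scheme V} (h : ValidOn G Set.univ I S) :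
    IsBroadcast 2 G I S := by
  induction S generalizing I with
  | nil => exact Set.univ_subset_iff.1 h
  | cons R S ih =>
      obtain ⟨h₁, h₂, h₃, h₄⟩ := h
      exact ⟨fun c hc => ⟨(h₁ c hc).1, (h₁ c hc).2.1, (h₁ c hc).2.2.1⟩, h₂, h₃, ih h₄⟩

theorem ValidOn.subset {U I : Set V} {R : List (Call V)} {S : Scheme V}
    (h : ValidOn G U I (R :: S)) (hI : I ⊆ U) : I ∪ {v | v ∈ R.map Prod.snd} ⊆ U := by
  rintro v (hv | hv)
  · exact hI hv
  · obtain ⟨c, hc, rfl⟩ := List.mem_map.1 hv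
    exact (h.1 c hc).2.2.2

theorem ValidOn.mem_called_iff {U I : Set V} {S : Scheme V} (h : ValidOn G U I S) (hI : I ⊆ U)
    (v : V) : v ∈ called S ↔ v ∈ U ∧ v ∉ I := by
  induction S generalizing I with
  | nil =>
      have : U ⊆ I := h
      simp only [called_nil, List.not_mem_nil, false_iff, not_and, not_not]
      exact fun hv => this hv
  | cons R S ih =>
      have hR := h.subset hI
      rw [called_cons, List.mem_append, ih h.2.2.2 hR]
      constructor
      · rintro (hv | ⟨hv, hv'⟩)
        · refine ⟨hR (Or.inr hv), ?_⟩
          obtain ⟨c, hc, rfl⟩ := List.mem_map.1 hv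
          exact (h.1 c hc).2.2.1
        · exact ⟨hv, fun h => hv' (Or.inl h)⟩
      · rintro ⟨hv, hv'⟩
        by_cases hvR : v ∈ R.map Prod.snd
        · exact Or.inl hvR
        · refine Or.inr ⟨hv, ?_⟩
          rintro (h | h)
          exacts [hv' h, hvR h]

theorem ValidOn.nodup_called {U I : Set V} {S : Scheme V} (h : ValidOn G U I S) (hI : I ⊆ U) :
    (called S).Nodup := by
  induction S generalizing I with
  | nil => simp
  | cons R S ih =>
      have hR := h.subset hI
      rw [called_cons, List.nodup_append]
      refine ⟨h.2.1, ih h.2.2.2 hR, ?_⟩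
      rintro a ha b hb rfl
      exact ((h.2.2.2.mem_called_iff hR a).1 hb).2 (Or.inr ha)

/-- For parallel schemes of different lengths: the part that is finished first becomes an inert
informed set `W`. -/
theorem ValidOn.frame {U I : Set V} {S : Scheme V} (W : Set V) (h : ValidOn G U I S)
    (hW : Disjoint W U) : ValidOn G (W ∪ U) (W ∪ I) S := by
  induction S generalizing I with
  | nil => exact Set.union_subset_union_right W h
  | cons R S ih =>
      obtain ⟨h₁, h₂, h₃, h₄⟩ := h
      refine ⟨fun c hc => ?_, h₂, h₃, ?_⟩
      · obtain ⟨ha, hi, hn, hu⟩ := h₁ c hc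
        refine ⟨ha, Or.inr hi, ?_, Or.inr hu⟩
        rintro (h | h)
        exacts [Set.disjoint_left.1 hW h hu, hn h]
      · rw [Set.union_assoc]
        exact ih h₄

theorem countP_caller_eq_zero {R : List (Call V)} {I : Set V} {u : V} (h : ∀ c ∈ R, c.1 ∈ I)
    (hu : u ∉ I) : R.countP (fun c => decide (c.1 = u)) = 0 := by
  rw [List.countP_eq_zero]
  intro c hc hcu
  exact hu (of_decide_eq_true hcu ▸ h c hc)

/-- Every call stays inside its own part, so disjointness suffices and edges between the parts do no
harm. A caller is informed in only one of the parts, so the bound of two calls is not doubled. -/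
theorem ValidOn.merge {U₁ U₂ I₁ I₂ : Set V} {A B : Scheme V} (hA : ValidOn G U₁ I₁ A)
    (hB : ValidOn G U₂ I₂ B) (hI₁ : I₁ ⊆ U₁) (hI₂ : I₂ ⊆ U₂) (hU : Disjoint U₁ U₂) :
    ValidOn G (U₁ ∪ U₂) (I₁ ∪ I₂) (mergeT A B).ret := by
  induction A generalizing B I₁ I₂ with
  | nil =>
      have : I₁ = U₁ := hI₁.antisymm hA
      subst this
      simpa using hB.frame I₁ hU
  | cons a A ih =>
      cases B with
      | nil =>
          have : I₂ = U₂ := hI₂.antisymm hB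
          subst this
          rw [mergeT_nil_right, Set.union_comm U₁, Set.union_comm I₁]
          exact hA.frame I₂ hU.symm
      | cons b B =>
          have hA' := hA.subset hI₁
          have hB' := hB.subset hI₂
          obtain ⟨ha₁, ha₂, ha₃, ha₄⟩ := hA
          obtain ⟨hb₁, hb₂, hb₃, hb₄⟩ := hB
          rw [mergeT_cons_cons]
          refine ⟨fun c hc => ?_, ?_, fun u => ?_, ?_⟩
          · rcases List.mem_append.1 hc with hc | hc
            · obtain ⟨h₁, h₂, h₃, h₄⟩ := ha₁ c hc
              exact ⟨h₁, Or.inl h₂, fun h => h.elim h₃ fun h =>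
                Set.disjoint_left.1 hU h₄ (hI₂ h), Or.inl h₄⟩
            · obtain ⟨h₁, h₂, h₃, h₄⟩ := hb₁ c hc
              exact ⟨h₁, Or.inr h₂, fun h => h.elim (fun h =>
                Set.disjoint_left.1 hU (hI₁ h) h₄) h₃, Or.inr h₄⟩
          · rw [List.map_append, List.nodup_append]
            refine ⟨ha₂, hb₂, ?_⟩
            rintro x hx y hy rfl
            exact Set.disjoint_left.1 hU (hA' (Or.inr hx)) (hB' (Or.inr hy))
          · rw [List.countP_append]
            by_cases hu : u ∈ I₁
            · have hu' : u ∉ I₂ := fun h => Set.disjoint_left.1 hU (hI₁ hu) (hI₂ h)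
              rw [countP_caller_eq_zero (fun c hc => (hb₁ c hc).2.1) hu']
              exact ha₃ u
            · rw [countP_caller_eq_zero (fun c hc => (ha₁ c hc).2.1) hu, Nat.zero_add]
              exact hb₃ u
          · have := ih ha₄ hb₄ hA' hB'
            convert this using 1
            ext v
            simp only [List.map_append, List.mem_append, Set.mem_union, Set.mem_ofPred_eq]
            tauto

/-- `S` is a valid scheme with super calls for the subgraph on `U`, which takes no more rounds than
any classic one, and not more rounds than calls. -/
structure Solves (G : SimpleGraph V) (U I : Set V) (S : Scheme V) : Prop where
  subset : I ⊆ U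
  valid : ValidOn G U I S
  length_le_of_feasible : ∀ r, Feasible G U I r → S.length ≤ r
  length_le : S.length ≤ S.flatten.length

theorem Solves.flatten_length_le [Fintype V] {U I : Set V} {S : Scheme V} (h : Solves G U I S) :
    S.flatten.length ≤ Fintype.card V := by
  rw [← length_called]
  exact (h.valid.nodup_called h.subset).length_le_card

end Schemes

/-! ### Jobs -/

section Jobs

variable {V : Type}

/-- The number of calls that belong to a job. -/
def jobCalls (j : Job V) : ℕ := j.1.length + j.2.flatten.length

/-- The number of calls that belong to the jobs in a list. -/
def jobsCalls (js : List (Job V)) : ℕ := (js.map jobCalls).sum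

/-- The vertices that are informed by a job. -/
def jobVerts (j : Job V) : Set V := {v | v ∈ called (j.1 :: j.2)}

/-- The vertex `s` and the vertices that are informed by its jobs. -/
def armVerts (a : V × List (Job V)) : Set V := {v | v = a.1 ∨ ∃ j ∈ a.2, v ∈ jobVerts j}

theorem insertT_perm (j : Job V) (l : List (Job V)) : (insertT j l).ret.Perm (j :: l) := by
  induction l with
  | nil => simp [insertT]
  | cons i l ih =>
      simp only [insertT, Timed.bind_ret, leT_ret, lengthT_ret]
      by_cases hc : i.2.length ≤ j.2.length
      · simp [hc]
      · simpa [hc] using (ih.cons i).trans (List.Perm.swap j i l)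

theorem sortT_perm (l : List (Job V)) : (sortT l).ret.Perm l := by
  induction l with
  | nil => simp [sortT]
  | cons j l ih =>
      simp only [sortT, Timed.bind_ret]
      exact (insertT_perm j _).trans (ih.cons j)

theorem insertT_pairwise (j : Job V) (l : List (Job V))
    (h : l.Pairwise fun i i' => i'.2.length ≤ i.2.length) :
    (insertT j l).ret.Pairwise fun i i' => i'.2.length ≤ i.2.length := by
  induction l with
  | nil => simp [insertT]
  | cons i l ih =>
      simp only [insertT, Timed.bind_ret, leT_ret, lengthT_ret]
      obtain ⟨h₁, h₂⟩ := List.pairwise_cons.1 h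
      by_cases hc : i.2.length ≤ j.2.length
      · simp only [hc, decide_true, if_true, Timed.pure_ret]
        refine List.pairwise_cons.2 ⟨fun i' hi' => ?_, h⟩
        rcases List.mem_cons.1 hi' with rfl | hi'
        exacts [hc, (h₁ i' hi').trans hc]
      · simp only [hc, decide_false, Bool.false_eq_true, if_false, Timed.bind_ret, Timed.pure_ret]
        refine List.pairwise_cons.2 ⟨fun i' hi' => ?_, ih h₂⟩
        rcases List.mem_cons.1 ((insertT_perm j l).subset hi') with rfl | hi'
        exacts [by omega, h₁ i' hi']

theorem sortT_pairwise (l : List (Job V)) :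
    (sortT l).ret.Pairwise fun i i' => i'.2.length ≤ i.2.length := by
  induction l with
  | nil => simp [sortT]
  | cons j l ih =>
      simp only [sortT, Timed.bind_ret]
      exact insertT_pairwise j _ ih

theorem insertT_time_le (j : Job V) (l : List (Job V)) {m : ℕ}
    (h : ∀ i ∈ j :: l, i.2.length ≤ m) : (insertT j l).time ≤ l.length * (2 * m + 4) + 1 := by
  induction l with
  | nil => simp [insertT]
  | cons i l ih =>
      have h₁ := h j (by simp)
      have h₂ := h i (by simp)
      have h₃ := ih fun i' hi' => h i' (by
        rcases List.mem_cons.1 hi' with rfl | hi' <;> simp [*])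
      simp only [insertT, Timed.bind_time, leT_ret, lengthT_ret, lengthT_time, leT_time,
        tick_time, List.length_cons]
      by_cases hc : i.2.length ≤ j.2.length
      · simp only [hc, decide_true, if_true, Timed.pure_time]
        nlinarith
      · simp only [hc, decide_false, Bool.false_eq_true, if_false, Timed.bind_time, Timed.pure_time]
        nlinarith

theorem sortT_time_le (l : List (Job V)) {m : ℕ} (h : ∀ i ∈ l, i.2.length ≤ m) :
    (sortT l).time ≤ l.length * (l.length * (2 * m + 4) + 2) + 1 := by
  induction l with
  | nil => simp [sortT]
  | cons j l ih =>
      have h₁ := ih fun i hi => h i (by simp [hi])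
      have hp := sortT_perm l
      have h₂ := insertT_time_le j (sortT l).ret (m := m) fun i hi => h i (by
        rcases List.mem_cons.1 hi with rfl | hi
        · simp
        · simp [hp.subset hi])
      rw [hp.length_eq] at h₂
      simp only [sortT, Timed.bind_time, tick_time, List.length_cons]
      nlinarith

theorem runJobsT_cons (j : Job V) (l : List (Job V)) :
    (runJobsT (j :: l)).ret = j.1 :: (mergeT j.2 (runJobsT l).ret).ret := by
  simp [runJobsT]

theorem runJobsT_flatten_length (l : List (Job V)) :
    (runJobsT l).ret.flatten.length = jobsCalls l := by
  induction l with
  | nil => simp [runJobsT, jobsCalls]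
  | cons j l ih =>
      have := mergeT_flatten_length j.2 (runJobsT l).ret
      simp only [jobsCalls] at ih
      simp only [runJobsT_cons, jobsCalls, jobCalls, List.flatten_cons, List.length_append,
        List.map_cons, List.sum_cons]
      omega

theorem runJobsT_length_le (l : List (Job V)) {r : ℕ}
    (h : ∀ A j B, l = A ++ j :: B → A.length + 1 + j.2.length ≤ r) :
    (runJobsT l).ret.length ≤ r := by
  induction l generalizing r with
  | nil => simp [runJobsT]
  | cons j l ih =>
      have h₁ := h [] j l rfl
      -- The tail starts one round later. The subtraction loses nothing, since `h₁` forces `r` to be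
      -- positive.
      have h₂ := ih (r := r - 1) fun A i B hl => by
        have := h (j :: A) i B (by simp [hl])
        simp only [List.length_cons] at this
        omega
      simp only [List.length_nil] at h₁
      simp only [runJobsT_cons, List.length_cons, mergeT_length]
      omega

/-- The order of descending broadcasting times is optimal. -/
theorem runJobsT_length_le_of_injOn (l : List (Job V)) {r : ℕ} (t : Job V → ℕ)
    (hl : l.Pairwise fun i i' => i'.2.length ≤ i.2.length) (hn : (l.map t).Nodup)
    (ht : ∀ j ∈ l, 1 ≤ t j ∧ j.2.length + t j ≤ r) : (runJobsT l).ret.length ≤ r := by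
  refine runJobsT_length_le l fun A j B hAB => ?_
  subst hAB
  -- Pigeonhole: `A.length + 1` distinct positive times cannot all be at most `A.length`. The job
  -- found precedes `j` or is `j` itself, so it runs at least as long, and it is opened no earlier
  -- than position `A.length + 1`; its own bound therefore implies that of `j`.
  have hex : ∃ i ∈ A ++ [j], A.length + 1 ≤ t i := by
    by_contra! hcon
    have hnd : ((A ++ [j]).map t).Nodup := by
      rw [List.append_cons, List.map_append] at hn
      exact (List.nodup_append.1 hn).1
    have hsub : ((A ++ [j]).map t).toFinset ⊆ Finset.Icc 1 A.length := by
      intro x hx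
      obtain ⟨i, hi, rfl⟩ := List.mem_map.1 (List.mem_toFinset.1 hx)
      have h₁ := hcon i hi
      have h₂ := (ht i (by
        rw [List.append_cons]
        exact List.mem_append_left _ hi)).1
      exact Finset.mem_Icc.2 ⟨h₂, by omega⟩
    have := Finset.card_le_card hsub
    rw [List.toFinset_card_of_nodup hnd] at this
    simp at this
  obtain ⟨i, hi, hti⟩ := hex
  have hr := (ht i (by
    rw [List.append_cons]
    exact List.mem_append_left _ hi)).2
  rcases List.mem_append.1 hi with hi | hi
  · have := (List.pairwise_append.1 hl).2.2 i hi j (by simp)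
    omega
  · rw [List.mem_singleton.1 hi] at hr hti
    omega

theorem jobsCalls_perm {l l' : List (Job V)} (h : l.Perm l') : jobsCalls l = jobsCalls l' :=
  (h.map jobCalls).sum_eq

theorem jobCalls_le_jobsCalls {l : List (Job V)} {j : Job V} (h : j ∈ l) :
    jobCalls j ≤ jobsCalls l :=
  List.single_le_sum (by simp) _ (List.mem_map_of_mem h)

theorem serveT_flatten_length (l : List (Job V)) :
    (serveT l).ret.flatten.length = jobsCalls l := by
  simp only [serveT, Timed.bind_ret, runJobsT_flatten_length]
  exact jobsCalls_perm (sortT_perm l)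

theorem armVerts_perm {s : V} {js js' : List (Job V)} (h : js.Perm js') :
    armVerts (s, js) = armVerts (s, js') := by
  ext v
  simp only [armVerts, Set.mem_ofPred_eq, h.mem_iff]

/-- Two parts of a graph are disjoint, and no edge joins them. -/
def Separate (G : SimpleGraph V) (A B : Set V) : Prop :=
  ∀ x ∈ A, ∀ y ∈ B, x ≠ y ∧ ¬ G.Adj x y

theorem Separate.symm {G : SimpleGraph V} {A B : Set V} (h : Separate G A B) : Separate G B A :=
  fun x hx y hy => ⟨(h y hy x hx).1.symm, fun hxy => (h y hy x hx).2 hxy.symm⟩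

variable [DecidableEq V]

/-- `j` is a job of the vertex `s` for a part of the graph in which it calls all of its neighbours
at once. -/
structure IsJob (G : SimpleGraph V) (s : V) (j : Job V) : Prop where
  caller : ∀ c ∈ j.1, c.1 = s
  ne_nil : j.1 ≠ []
  length_le_two : j.1.length ≤ 2
  mem_iff : ∀ v, v ∈ j.1.map Prod.snd ↔ v ∈ jobVerts j ∧ G.Adj s v
  nodup : (j.1.map Prod.snd).Nodup
  solves : Solves G (jobVerts j) {v | v ∈ j.1.map Prod.snd} j.2
  notMem : s ∉ jobVerts j

/-- Jobs of the vertex `s` for separate parts of the graph. -/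
structure AreJobs (G : SimpleGraph V) (s : V) (js : List (Job V)) : Prop where
  isJob : ∀ j ∈ js, IsJob G s j
  pairwise : js.Pairwise fun i j => Separate G (jobVerts i) (jobVerts j)

variable {G : SimpleGraph V} {s : V}

/-- The opening call gives the strict inequality. It lets rounds and numbers of jobs be charged to
calls. -/
theorem IsJob.length_lt {j : Job V} (h : IsJob G s j) : j.2.length < jobCalls j := by
  have h₁ := h.solves.length_le
  have h₂ := List.length_pos_iff.2 h.ne_nil
  unfold jobCalls
  omega

theorem IsJob.nonempty {j : Job V} (h : IsJob G s j) : (jobVerts j).Nonempty := by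
  obtain ⟨c, hc⟩ := List.exists_mem_of_ne_nil _ h.ne_nil
  exact ⟨c.2, ((h.mem_iff c.2).1 (List.mem_map_of_mem hc)).1⟩

theorem AreJobs.perm {js js' : List (Job V)} (h : AreJobs G s js) (hp : js.Perm js') :
    AreJobs G s js' :=
  ⟨fun j hj => h.isJob j (hp.symm.subset hj),
    (hp.pairwise_iff fun {_ _} hx => hx.symm).1 h.pairwise⟩

theorem AreJobs.nodup {js : List (Job V)} (h : AreJobs G s js) : js.Nodup := by
  refine (List.Pairwise.and_mem.1 h.pairwise).imp ?_
  rintro i _ ⟨hi, -, hij⟩ rfl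
  obtain ⟨x, hx⟩ := (h.isJob i hi).nonempty
  exact (hij x hx x hx).1 rfl

theorem AreJobs.length_le {js : List (Job V)} (h : AreJobs G s js) :
    js.length ≤ jobsCalls js := by
  have : (js.map fun _ => 1).sum ≤ (js.map jobCalls).sum :=
    List.sum_le_sum fun j hj => by have := (h.isJob j hj).length_lt; omega
  simpa [jobsCalls] using this

theorem AreJobs.separate {js : List (Job V)} (h : AreJobs G s js) {i j : Job V} (hi : i ∈ js)
    (hj : j ∈ js) (hij : i ≠ j) : Separate G (jobVerts i) (jobVerts j) := by
  have : Std.Symm fun i j : Job V => Separate G (jobVerts i) (jobVerts j) := ⟨fun _ _ h => h.symm⟩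
  exact h.pairwise.forall hi hj hij

theorem AreJobs.validOn_runJobsT {js : List (Job V)} (h : AreJobs G s js) :
    ValidOn G (armVerts (s, js)) {s} (runJobsT js).ret := by
  induction js with
  | nil =>
      simp only [runJobsT, Timed.bind_ret, Timed.pure_ret]
      rintro v (hv | ⟨j, hj, -⟩)
      exacts [hv, absurd hj (by simp)]
  | cons j js ih =>
      have hj := h.isJob j (by simp)
      obtain ⟨hp₁, hp₂⟩ := List.pairwise_cons.1 h.pairwise
      have hv := ih ⟨fun i hi => h.isJob i (by simp [hi]), hp₂⟩
      have hdisj : Disjoint (jobVerts j) (armVerts (s, js)) := by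
        rw [Set.disjoint_left]
        rintro v hv (hs | ⟨i, hi, hvi⟩)
        · exact hj.notMem ((show v = s from hs) ▸ hv)
        · exact (hp₁ i hi v hv v hvi).1 rfl
      have hm := hj.solves.valid.merge hv hj.solves.subset
        (Set.singleton_subset_iff.2 (Or.inl rfl)) hdisj
      have hU : armVerts (s, j :: js) = jobVerts j ∪ armVerts (s, js) := by
        ext v
        simp only [armVerts, Set.mem_ofPred_eq, List.mem_cons, exists_eq_or_imp, Set.mem_union]
        tauto
      rw [runJobsT_cons, hU]
      refine ⟨fun c hc => ?_, hj.nodup, fun u => ?_, ?_⟩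
      · have hcs := hj.caller c hc
        obtain ⟨h₁, h₂⟩ := (hj.mem_iff c.2).1 (List.mem_map_of_mem hc)
        refine ⟨hcs ▸ h₂, hcs, ?_, Or.inl h₁⟩
        intro he
        exact hj.notMem ((Set.mem_singleton_iff.1 he) ▸ h₁)
      -- Only the opening calls of `j` are made in this round; everything else starts later.
      · exact List.countP_le_length.trans hj.length_le_two
      · rw [Set.union_comm {s}]
        exact hm

theorem AreJobs.length_runJobsT_le {js : List (Job V)} (h : AreJobs G s js) :
    (runJobsT js).ret.length ≤ jobsCalls js := by
  induction js with
  | nil => simp [runJobsT]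
  | cons j js ih =>
      have hj := (h.isJob j (by simp)).length_lt
      have := ih ⟨fun i hi => h.isJob i (by simp [hi]), (List.pairwise_cons.1 h.pairwise).2⟩
      simp only [jobsCalls] at this
      simp only [runJobsT_cons, List.length_cons, mergeT_length, jobsCalls, List.map_cons,
        List.sum_cons]
      omega

theorem AreJobs.runJobsT_time_le {js : List (Job V)} (h : AreJobs G s js) :
    (runJobsT js).time ≤ 3 * jobsCalls js + 1 := by
  induction js with
  | nil => simp [runJobsT]
  | cons j js ih =>
      have h₁ := (h.isJob j (by simp)).length_lt
      have h₂ := List.length_pos_iff.2 (h.isJob j (by simp)).ne_nil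
      have h₃ := ih ⟨fun i hi => h.isJob i (by simp [hi]), (List.pairwise_cons.1 h.pairwise).2⟩
      have h₄ := mergeT_time_le j.2 (runJobsT js).ret
      simp only [jobCalls] at h₁
      simp only [jobsCalls] at h₃
      simp only [runJobsT, Timed.bind_time, tick_time, Timed.pure_time, jobsCalls, List.map_cons,
        List.sum_cons]
      have h₅ : jobCalls j = j.1.length + j.2.flatten.length := rfl
      omega

/-- A classic broadcast from `s` opens the parts of the graph one after the other. -/
theorem AreJobs.exists_opening {js : List (Job V)} (h : AreJobs G s js) {r : ℕ}
    (hf : Feasible G (armVerts (s, js)) {s} r) :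
    ∃ t : Job V → ℕ, (js.map t).Nodup ∧ ∀ j ∈ js, 1 ≤ t j ∧ j.2.length + t j ≤ r := by
  classical
  obtain ⟨τ, π, h₁, h₂⟩ := hf
  have hmem : ∀ j ∈ js, ∀ v ∈ jobVerts j, v ∈ armVerts (s, js) ∧ v ∉ ({s} : Set V) :=
    fun j hj v hv => ⟨Or.inr ⟨j, hj, hv⟩, fun he =>
      (h.isJob j hj).notMem (Set.mem_singleton_iff.1 he ▸ hv)⟩
  -- No edge joins two parts, so a part can be entered only from `s`.
  have hstay : ∀ j ∈ js, ∀ v ∈ jobVerts j, π v = s ∨ π v ∈ jobVerts j := by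
    intro j hj v hv
    obtain ⟨hv₁, hv₂⟩ := hmem j hj v hv
    obtain ⟨hu, ha, -, -⟩ := h₁ v hv₁ hv₂
    rcases hu with hu | ⟨i, hi, hvi⟩
    · exact Or.inl hu
    · by_cases hij : i = j
      · exact Or.inr (hij ▸ hvi)
      · exact absurd ha (h.separate hi hj hij _ hvi _ hv).2
  have hmin : ∀ j ∈ js, ∃ v ∈ jobVerts j, ∀ w ∈ jobVerts j, τ v ≤ τ w := by
    intro j hj
    obtain ⟨x, hx⟩ := (h.isJob j hj).nonempty
    obtain ⟨v, hv, hvm⟩ := WellFounded.has_min (measure τ).wf (jobVerts j) ⟨x, hx⟩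
    exact ⟨v, hv, fun w hw => not_lt.1 (hvm w hw)⟩
  have : Nonempty V := ⟨s⟩
  choose! v hv hvmin using hmin
  -- An informer inside the part would have an earlier time than the earliest vertex.
  have hπ : ∀ j ∈ js, π (v j) = s := by
    intro j hj
    obtain ⟨hv₁, hv₂⟩ := hmem j hj _ (hv j hj)
    refine (hstay j hj _ (hv j hj)).resolve_right fun hm => ?_
    have := hvmin j hj _ hm
    have := (h₁ _ hv₁ hv₂).2.2.1
    omega
  refine ⟨fun j => τ (v j), ?_, fun j hj => ?_⟩
  · refine List.Nodup.map_on (fun i hi j hj hij => ?_) h.nodup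
    by_contra hne
    obtain ⟨hi₁, hi₂⟩ := hmem i hi _ (hv i hi)
    obtain ⟨hj₁, hj₂⟩ := hmem j hj _ (hv j hj)
    have := h₂ _ hi₁ hi₂ _ hj₁ hj₂ ((hπ i hi).trans (hπ j hj).symm) hij
    exact (h.separate hi hj hne _ (hv i hi) _ (hv j hj)).1 this
  · obtain ⟨hv₁, hv₂⟩ := hmem j hj _ (hv j hj)
    obtain ⟨-, -, hlt, hle⟩ := h₁ _ hv₁ hv₂
    refine ⟨Nat.one_le_iff_ne_zero.2 (Nat.ne_zero_of_lt hlt), ?_⟩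
    -- The clock restarts when the part is opened. No vertex of the part has a smaller time than `v
    -- j`, so truncated subtraction preserves the order. All neighbours of `s` in the part count as
    -- informed, so the remaining vertices have their informers inside it.
    have hfeas : Feasible G (jobVerts j) {v | v ∈ j.1.map Prod.snd} (r - τ (v j)) := by
      refine ⟨fun w => τ w - τ (v j), π, fun w hw hwN => ?_, fun w hw hwN x hx hxN hπwx hτ => ?_⟩
      · obtain ⟨hw₁, hw₂⟩ := hmem j hj w hw
        obtain ⟨-, ha, hlt', hle'⟩ := h₁ w hw₁ hw₂
        have hst : π w ∈ jobVerts j := (hstay j hj w hw).resolve_left fun he =>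
          hwN (((h.isJob j hj).mem_iff w).2 ⟨hw, he ▸ ha⟩)
        have := hvmin j hj _ hst
        have := hvmin j hj _ hw
        exact ⟨hst, ha, by beta_reduce; omega, by beta_reduce; omega⟩
      · obtain ⟨hw₁, hw₂⟩ := hmem j hj w hw
        obtain ⟨hx₁, hx₂⟩ := hmem j hj x hx
        have := hvmin j hj _ hw
        have := hvmin j hj _ hx
        beta_reduce at hτ
        exact h₂ w hw₁ hw₂ x hx₁ hx₂ hπwx (by omega)
    have := (h.isJob j hj).solves.length_le_of_feasible _ hfeas
    beta_reduce
    omega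

theorem AreJobs.solves_serveT {js : List (Job V)} (h : AreJobs G s js) :
    Solves G (armVerts (s, js)) {s} (serveT js).ret := by
  have hp := sortT_perm js
  have h' := h.perm hp.symm
  rw [← armVerts_perm hp]
  simp only [serveT, Timed.bind_ret]
  refine ⟨Set.singleton_subset_iff.2 (Or.inl rfl), h'.validOn_runJobsT, fun r hr => ?_, ?_⟩
  · obtain ⟨t, ht₁, ht₂⟩ := h'.exists_opening hr
    exact runJobsT_length_le_of_injOn _ t (sortT_pairwise js) ht₁ ht₂
  · rw [runJobsT_flatten_length]
    exact h'.length_runJobsT_le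

/-- A bound for the cost of serving jobs with at most `n` calls. -/
def serveCost (n : ℕ) : ℕ := n * (n * (2 * n + 4) + 2) + 3 * n + 3

theorem AreJobs.serveT_time_le {js : List (Job V)} (h : AreJobs G s js) {n : ℕ}
    (hn : jobsCalls js ≤ n) : (serveT js).time ≤ serveCost n := by
  have hp := sortT_perm js
  have h' := h.perm hp.symm
  have h₁ := h'.runJobsT_time_le
  rw [jobsCalls_perm hp] at h₁
  have h₂ := sortT_time_le js (m := n) fun i hi =>
    ((h.isJob i hi).length_lt.le.trans (jobCalls_le_jobsCalls hi)).trans hn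
  have h₃ := h.length_le.trans hn
  have h₄ : js.length * (js.length * (2 * n + 4) + 2) ≤ n * (n * (2 * n + 4) + 2) := by gcongr
  simp only [serveT, Timed.bind_time, tick_time, serveCost]
  omega

end Jobs


/-! ### Broadcasting along a path -/

section Arms

variable {V : Type}

/-- The vertices of a path together with those that are informed by its jobs. -/
def armsVerts (l : List (V × List (Job V))) : Set V := {v | ∃ a ∈ l, v ∈ armVerts a}

/-- The number of calls in the jobs along a path. -/
def armsCalls (l : List (V × List (Job V))) : ℕ := (l.map fun a => jobsCalls a.2).sum

theorem mem_armsVerts_of_mem {l : List (V × List (Job V))} {a : V × List (Job V)} (h : a ∈ l) :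
    a.1 ∈ armsVerts l := ⟨a, h, Or.inl rfl⟩

theorem armsVerts_append (l l' : List (V × List (Job V))) :
    armsVerts (l ++ l') = armsVerts l ∪ armsVerts l' := by
  ext v
  simp only [armsVerts, List.mem_append, or_and_right, exists_or, Set.mem_union, Set.mem_ofPred_eq]

theorem armsVerts_singleton (a : V × List (Job V)) : armsVerts [a] = armVerts a := by
  ext v
  simp [armsVerts]

theorem armsVerts_cons (a : V × List (Job V)) (l : List (V × List (Job V))) :
    armsVerts (a :: l) = armVerts a ∪ armsVerts l := by
  rw [← List.singleton_append, armsVerts_append, armsVerts_singleton]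

theorem armsVerts_reverse (l : List (V × List (Job V))) :
    armsVerts l.reverse = armsVerts l := by
  ext v
  simp [armsVerts]

theorem armsCalls_append (l l' : List (V × List (Job V))) :
    armsCalls (l ++ l') = armsCalls l + armsCalls l' := by
  simp [armsCalls]

theorem armsCalls_reverse (l : List (V × List (Job V))) :
    armsCalls l.reverse = armsCalls l := by
  simp [armsCalls]

/-- The summand 1 appears because a path has one edge fewer than vertices; the empty path would
violate the equation. -/
theorem chainT_flatten_length (l : List (V × List (Job V))) (h : l ≠ []) :
    (chainT l).ret.flatten.length + 1 = armsCalls l + l.length := by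
  induction l with
  | nil => exact absurd rfl h
  | cons a l ih =>
      cases l with
      | nil =>
          have := serveT_flatten_length a.2
          simp only [chainT, Timed.bind_ret, armsCalls, List.map_cons, List.map_nil,
            List.sum_cons, List.sum_nil, List.length_cons, List.length_nil]
          omega
      | cons b l =>
          have h₁ := ih (by simp)
          have h₂ := serveT_flatten_length (([(a.1, b.1)], (chainT (b :: l)).ret) :: a.2)
          simp only [jobsCalls, List.map_cons, List.sum_cons, jobCalls, List.length_cons,
            List.length_nil] at h₂
          simp only [armsCalls, List.map_cons, List.sum_cons, List.length_cons, jobsCalls] at h₁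
          simp only [chainT, Timed.bind_ret, armsCalls, List.map_cons, List.sum_cons,
            List.length_cons, jobsCalls]
          omega

/-- The best split of a path is at least as good as all other ones. -/
theorem bestSplitT_spec (left right : List (V × List (Job V))) (h : right ≠ []) :
    ∃ S, (bestSplitT left right).ret = some S ∧
      (∃ A B, right = A ++ B ∧ B ≠ [] ∧
        S = (mergeT (chainT (left.reverse ++ A)).ret (chainT B.reverse).ret).ret) ∧
      ∀ A B, right = A ++ B → B ≠ [] → S.length ≤
        (mergeT (chainT (left.reverse ++ A)).ret (chainT B.reverse).ret).ret.length := by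
  induction right generalizing left with
  | nil => exact absurd rfl h
  | cons q right ih =>
      simp only [bestSplitT, Timed.bind_ret, reverseT_ret, List.append_nil]
      generalize hM : (mergeT (chainT left.reverse).ret (chainT (q :: right).reverse).ret).ret = M
      by_cases hr : right = []
      · subst hr
        refine ⟨M, by simp [bestSplitT], ⟨[], [q], by simp, by simp, by simpa using hM.symm⟩, ?_⟩
        intro A B hAB hB
        have : A = [] := by
          cases A with
          | nil => rfl
          | cons a A =>
              simp only [List.cons_append, List.cons.injEq, List.nil_eq, List.append_eq_nil_iff]
                at hAB
              exact absurd hAB.2.2 hB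
        subst this
        rw [List.nil_append] at hAB
        subst hAB
        simp only [List.append_nil, hM, le_refl]
      · obtain ⟨S, hS, ⟨A₀, B₀, hAB₀, hB₀, hS₀⟩, hmin⟩ := ih (q :: left) hr
        simp only [List.reverse_cons, List.append_assoc, List.singleton_append] at hS₀ hmin
        simp only [hS]
        -- Whatever is at most as long as `M`, the split at the current edge, and `S`, the best
        -- later split, beats all splits.
        have hall : ∀ (S' : Scheme V), S'.length ≤ M.length → S'.length ≤ S.length →
            ∀ A B, q :: right = A ++ B → B ≠ [] → S'.length ≤
              (mergeT (chainT (left.reverse ++ A)).ret (chainT B.reverse).ret).ret.length := by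
          intro S' h₁ h₂ A B hAB hB
          cases A with
          | nil =>
              rw [List.nil_append] at hAB
              subst hAB
              simpa only [List.append_nil, hM] using h₁
          | cons a A =>
              simp only [List.cons_append, List.cons.injEq] at hAB
              obtain ⟨rfl, hAB⟩ := hAB
              exact h₂.trans (hmin A B hAB hB)
        by_cases hc : M.length ≤ S.length
        · refine ⟨M, by simp [hc], ⟨[], q :: right, rfl, by simp, ?_⟩, hall M le_rfl hc⟩
          rw [List.append_nil, hM]
        · exact ⟨S, by simp [hc], ⟨q :: A₀, B₀, by simp [hAB₀], hB₀, hS₀⟩,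
            hall S (by omega) le_rfl⟩

variable [DecidableEq V]

/-- The vertices of a path with their jobs, such that every edge of the path is the only one
between the parts of the graph before and after it. -/
structure IsArms (G : SimpleGraph V) (l : List (V × List (Job V))) : Prop where
  areJobs : ∀ a ∈ l, AreJobs G a.1 a.2
  split : ∀ A a b B, l = A ++ a :: b :: B → G.Adj a.1 b.1 ∧
    ∀ x ∈ armsVerts (A ++ [a]), ∀ y ∈ armsVerts (b :: B),
      x ≠ y ∧ (G.Adj x y → x = a.1 ∧ y = b.1)

variable {G : SimpleGraph V}

theorem IsArms.of_append_left {l l' : List (V × List (Job V))} (h : IsArms G (l ++ l')) :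
    IsArms G l := by
  refine ⟨fun a ha => h.areJobs a (by simp [ha]), fun A a b B hl => ?_⟩
  obtain ⟨h₁, h₂⟩ := h.split A a b (B ++ l') (by simp [hl])
  refine ⟨h₁, fun x hx y hy => h₂ x hx y ?_⟩
  rw [← List.cons_append, armsVerts_append]
  exact Or.inl hy

theorem IsArms.of_append_right {l l' : List (V × List (Job V))} (h : IsArms G (l ++ l')) :
    IsArms G l' := by
  refine ⟨fun a ha => h.areJobs a (by simp [ha]), fun A a b B hl => ?_⟩
  obtain ⟨h₁, h₂⟩ := h.split (l ++ A) a b B (by simp [hl])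
  refine ⟨h₁, fun x hx y hy => h₂ x ?_ y hy⟩
  rw [List.append_assoc, armsVerts_append]
  exact Or.inr hx

theorem IsArms.reverse {l : List (V × List (Job V))} (h : IsArms G l) : IsArms G l.reverse := by
  refine ⟨fun a ha => h.areJobs a (by simpa using ha), fun A a b B hl => ?_⟩
  have hl' : l = B.reverse ++ b :: a :: A.reverse := by
    have := congrArg List.reverse hl
    simpa using this
  obtain ⟨h₁, h₂⟩ := h.split _ _ _ _ hl'
  refine ⟨h₁.symm, fun x hx y hy => ?_⟩
  rw [← armsVerts_reverse] at hx hy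
  obtain ⟨h₃, h₄⟩ := h₂ y (by simpa using hy) x (by simpa using hx)
  exact ⟨h₃.symm, fun hxy => (h₄ hxy.symm).symm⟩

/-- The job of informing the rest of a path is one more job of its first vertex. -/
theorem IsArms.areJobs_cons {a b : V × List (Job V)} {l : List (V × List (Job V))}
    (h : IsArms G (a :: b :: l)) {S : Scheme V} (hS : Solves G (armsVerts (b :: l)) {b.1} S) :
    AreJobs G a.1 (([(a.1, b.1)], S) :: a.2) ∧
      jobVerts ([(a.1, b.1)], S) = armsVerts (b :: l) := by
  have hb : b.1 ∈ armsVerts (b :: l) := mem_armsVerts_of_mem (by simp)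
  have hv : jobVerts ([(a.1, b.1)], S) = armsVerts (b :: l) := by
    ext v
    have := hS.valid.mem_called_iff hS.subset v
    simp only [Set.mem_singleton_iff] at this
    simp only [jobVerts, called_cons, List.map_cons, List.map_nil, List.singleton_append,
      List.mem_cons, Set.mem_ofPred_eq, this]
    by_cases hvb : v = b.1
    · simp [hvb, hb]
    · simp [hvb]
  obtain ⟨hab, hcross⟩ := h.split [] a b l rfl
  rw [List.nil_append, armsVerts_singleton] at hcross
  have hj := h.areJobs a (by simp)
  refine ⟨⟨fun j hj' => ?_, List.pairwise_cons.2 ⟨fun j hj' => ?_, hj.pairwise⟩⟩, hv⟩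
  · rcases List.mem_cons.1 hj' with rfl | hj'
    · refine ⟨by simp, by simp, by simp, fun v => ?_, by simp, ?_, ?_⟩
      · rw [hv]
        simp only [List.map_cons, List.map_nil, List.mem_singleton]
        exact ⟨fun hvb => hvb ▸ ⟨hb, hab⟩, fun hva =>
          ((hcross a.1 (Or.inl rfl) v hva.1).2 hva.2).2⟩
      · rw [hv]
        simpa using hS
      · rw [hv]
        exact fun ha => (hcross a.1 (Or.inl rfl) a.1 ha).1 rfl
    · exact hj.isJob j hj'
  · rw [hv]
    intro x hx y hy
    -- The only edge from this side into the rest of the path starts at `a.1`, and `a.1` belongs to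
    -- none of its own jobs.
    obtain ⟨h₁, h₂⟩ := hcross y (Or.inr ⟨j, hj', hy⟩) x hx
    refine ⟨h₁.symm, fun hxy => (hj.isJob j hj').notMem ?_⟩
    rw [← (h₂ hxy.symm).1]
    exact hy

/-- By induction from the far end, optimality of a chain is an instance of the single-source case
`AreJobs.solves_serveT`. -/
theorem IsArms.solves_chainT {a : V × List (Job V)} {l : List (V × List (Job V))}
    (h : IsArms G (a :: l)) : Solves G (armsVerts (a :: l)) {a.1} (chainT (a :: l)).ret := by
  induction l generalizing a with
  | nil =>
      rw [armsVerts_singleton]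
      simpa [chainT] using (h.areJobs a (by simp)).solves_serveT
  | cons b l ih =>
      have hS := ih (IsArms.of_append_right (l := [a]) h)
      obtain ⟨hj, hv⟩ := h.areJobs_cons hS
      simp only [chainT, Timed.bind_ret]
      convert hj.solves_serveT using 1
      ext v
      rw [armsVerts_cons]
      simp only [armVerts, Set.mem_ofPred_eq, List.mem_cons, exists_eq_or_imp, Set.mem_union, hv]
      exact or_right_comm.trans or_assoc

theorem IsArms.chainT_time_le {l : List (V × List (Job V))} (h : IsArms G l) {n : ℕ}
    (hn : armsCalls l + l.length ≤ n + 1) :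
    (chainT l).time ≤ l.length * (serveCost n + 1) + 1 := by
  induction l with
  | nil => simp [chainT]
  | cons a l ih =>
      cases l with
      | nil =>
          have := (h.areJobs a (by simp)).serveT_time_le (n := n) (by
            simp only [armsCalls, List.map_cons, List.map_nil, List.sum_cons, List.sum_nil,
              List.length_cons, List.length_nil] at hn
            omega)
          simp only [chainT, Timed.bind_time, tick_time, List.length_cons, List.length_nil]
          omega
      | cons b l =>
          have h' : IsArms G (b :: l) := IsArms.of_append_right (l := [a]) h
          have hc := chainT_flatten_length (b :: l) (by simp)
          simp only [armsCalls, List.map_cons, List.sum_cons, List.length_cons] at hn hc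
          have h₁ := ih h' (by
            simp only [armsCalls, List.map_cons, List.sum_cons, List.length_cons]
            omega)
          have h₂ := (h.areJobs_cons h'.solves_chainT).1.serveT_time_le (n := n) (by
            simp only [jobsCalls, List.map_cons, List.sum_cons, jobCalls, List.length_cons,
              List.length_nil] at hn hc ⊢
            omega)
          simp only [chainT, Timed.bind_time, tick_time, List.length_cons] at h₁ ⊢
          nlinarith

/-- A classic broadcast from both ends of a path does not use all of its edges. -/
theorem exists_unused_edge (π : V → V) (A : List (V × List (Job V))) (a b : V × List (Job V))
    (B : List (V × List (Job V))) (hA : A = [] ∨ ∃ c ∈ A, π a.1 = c.1) :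
    ∃ A' a' b' B', A ++ a :: b :: B = A' ++ a' :: b' :: B' ∧
      (A' = [] ∨ ∃ c ∈ A', π a'.1 = c.1) ∧ (B' = [] ∨ π b'.1 ≠ a'.1) := by
  induction B generalizing A a b with
  | nil => exact ⟨A, a, b, [], rfl, hA, Or.inl rfl⟩
  | cons d B ih =>
      -- If the edge carries a call from left to right, then `b` has its informer on the left and
      -- the search moves on. It may end at the last edge unconditionally, because the right end of
      -- that edge will be a source.
      by_cases hπ : π b.1 = a.1
      · obtain ⟨A', a', b', B', h₁, h₂⟩ := ih (A ++ [a]) b d (Or.inr ⟨a, by simp, hπ⟩)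
        exact ⟨A', a', b', B', by rw [← h₁]; simp, h₂⟩
      · exact ⟨A, a, b, d :: B, rfl, hA, Or.inr hπ⟩

/-- List bookkeeping for the cut at the edge `a b`: the left piece starts at `p`, the right piece
ends at `q`, and the degenerate cases say that `a` or `b` is itself a source. -/
theorem append_cons_cons_eq {α : Type} {p q : α} {l A B : List α} {a b : α}
    (h : p :: (l ++ [q]) = A ++ a :: b :: B) :
    (∃ A', A ++ [a] = p :: A') ∧ (∃ B', b :: B = B' ++ [q]) ∧ (A = [] → a = p) ∧
      (B = [] → b = q) := by
  refine ⟨?_, ?_, ?_, ?_⟩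
  · cases A with
    | nil =>
        simp only [List.nil_append, List.cons.injEq] at h
        exact ⟨[], by simp [h.1]⟩
    | cons c A =>
        simp only [List.cons_append, List.cons.injEq] at h
        exact ⟨A ++ [a], by simp [h.1]⟩
  · have h' := congrArg List.reverse h
    simp only [List.reverse_cons, List.reverse_append, List.reverse_nil, List.nil_append,
      List.append_assoc, List.cons_append] at h'
    rcases List.eq_nil_or_concat B with rfl | ⟨B', d, rfl⟩
    · simp only [List.reverse_nil, List.nil_append, List.cons.injEq] at h'
      exact ⟨[], by simp [h'.1]⟩
    · simp only [List.concat_eq_append, List.reverse_append, List.reverse_cons, List.reverse_nil,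
        List.nil_append, List.cons_append, List.cons.injEq] at h'
      exact ⟨b :: B', by simp [h'.1]⟩
  · rintro rfl
    simp only [List.nil_append, List.cons.injEq] at h
    exact h.1.symm
  · rintro rfl
    have h' := congrArg List.reverse h
    simp only [List.reverse_cons, List.reverse_append, List.reverse_nil, List.nil_append,
      List.cons_append, List.cons.injEq] at h'
    exact h'.1.symm

/-- A classic broadcast from both ends of a path splits into two at some edge of the path. -/
theorem IsArms.exists_split_feasible {p q : V × List (Job V)} {l : List (V × List (Job V))}
    (h : IsArms G (p :: (l ++ [q]))) {r : ℕ}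
    (hf : Feasible G (armsVerts (p :: (l ++ [q]))) {p.1, q.1} r) :
    ∃ A B, p :: (l ++ [q]) = (p :: A) ++ (B ++ [q]) ∧ Feasible G (armsVerts (p :: A)) {p.1} r ∧
      Feasible G (armsVerts (B ++ [q])) {q.1} r := by
  obtain ⟨τ, π, h₁, h₂⟩ := hf
  obtain ⟨A, a, b, B, hl, hA, hB⟩ : ∃ A a b B, p :: (l ++ [q]) = A ++ a :: b :: B ∧
      (A = [] ∨ ∃ c ∈ A, π a.1 = c.1) ∧ (B = [] ∨ π b.1 ≠ a.1) := by
    cases l with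
    | nil => exact exists_unused_edge π [] p q [] (Or.inl rfl)
    | cons d l => exact exists_unused_edge π [] p d (l ++ [q]) (Or.inl rfl)
  obtain ⟨⟨A', hA'⟩, ⟨B', hB'⟩, hAp, hBq⟩ := append_cons_cons_eq hl
  have hcross := (h.split A a b B hl).2
  have hlist : p :: (l ++ [q]) = (p :: A') ++ (B' ++ [q]) := by
    rw [hl, ← hA', ← hB']
    simp
  rw [hlist, armsVerts_append] at h₁ h₂
  rw [hA', hB'] at hcross
  have haL : a.1 ∈ armsVerts (p :: A') := hA' ▸ mem_armsVerts_of_mem (by simp)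
  have hbR : b.1 ∈ armsVerts (B' ++ [q]) := hB' ▸ mem_armsVerts_of_mem (by simp)
  have hpL : p.1 ∈ armsVerts (p :: A') := mem_armsVerts_of_mem (by simp)
  have hqR : q.1 ∈ armsVerts (B' ++ [q]) := mem_armsVerts_of_mem (by simp)
  have hL : ∀ v ∈ armsVerts (p :: A'), v ∉ ({p.1} : Set V) → v ∉ ({p.1, q.1} : Set V) := by
    rintro v hv hvp (hv' | hv')
    exacts [hvp hv', (hcross v hv q.1 hqR).1 hv']
  have hR : ∀ v ∈ armsVerts (B' ++ [q]), v ∉ ({q.1} : Set V) → v ∉ ({p.1, q.1} : Set V) := by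
    rintro v hv hvq (hv' | hv')
    exacts [(hcross p.1 hpL v hv).1 hv'.symm, hvq hv']
  refine ⟨A', B', hlist, ⟨τ, π, fun v hv hvp => ?_, fun v hv hvp w hw hwp => ?_⟩,
    ⟨τ, π, fun v hv hvq => ?_, fun v hv hvq w hw hwq => ?_⟩⟩
  · obtain ⟨h₃, h₄, h₅⟩ := h₁ v (Or.inl hv) (hL v hv hvp)
    -- An informer on the right would have to be `b` informing `a`; but `a` is the source `p` or has
    -- its informer in `A`.
    refine ⟨h₃.resolve_right fun hπ => ?_, h₄, h₅⟩
    obtain ⟨hva, hvb⟩ := (hcross v hv _ hπ).2 h₄.symm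
    rcases hA with rfl | ⟨c, hc, hπc⟩
    · exact hvp (by rw [hva, hAp rfl]; rfl)
    · refine (hcross c.1 ?_ _ hπ).1 ?_
      · rw [← hA']
        exact mem_armsVerts_of_mem (by simp [hc])
      · rw [hva, hπc]
  · exact h₂ v (Or.inl hv) (hL v hv hvp) w (Or.inl hw) (hL w hw hwp)
  · obtain ⟨h₃, h₄, h₅⟩ := h₁ v (Or.inr hv) (hR v hv hvq)
    -- An informer on the left would have to be `a` informing `b`, which the choice of the edge
    -- excludes unless `b` is the source `q`.
    refine ⟨h₃.resolve_left fun hπ => ?_, h₄, h₅⟩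
    obtain ⟨hπa, hvb⟩ := (hcross _ hπ v hv).2 h₄
    rcases hB with rfl | hπb
    · exact hvq (by rw [hvb, hBq rfl]; rfl)
    · exact hπb (by rw [← hvb, hπa])
  · exact h₂ v (Or.inr hv) (hR v hv hvq) w (Or.inr hw) (hR w hw hwq)

/-- Splitting the path at its best edge solves the problem with both ends informed. -/
theorem IsArms.solves_bestSplitT {p q : V × List (Job V)} {l : List (V × List (Job V))}
    (h : IsArms G (p :: (l ++ [q]))) :
    ∃ S, (bestSplitT [p] (l ++ [q])).ret = some S ∧
      Solves G (armsVerts (p :: (l ++ [q]))) {p.1, q.1} S ∧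
      S.flatten.length + 2 = armsCalls (p :: (l ++ [q])) + (p :: (l ++ [q])).length := by
  obtain ⟨S, hS, ⟨A, B, hAB, hB, hSAB⟩, hmin⟩ := bestSplitT_spec [p] (l ++ [q]) (by simp)
  simp only [List.reverse_singleton, List.singleton_append] at hSAB hmin
  refine ⟨S, hS, ?_, ?_⟩
  · obtain ⟨B, rfl⟩ : ∃ B', B = B' ++ [q] := by
      rcases List.eq_nil_or_concat B with rfl | ⟨B', d, rfl⟩
      · exact absurd rfl hB
      · rw [List.concat_eq_append, ← List.append_assoc] at hAB
        have := (List.append_inj' hAB rfl).2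
        simp only [List.cons.injEq, and_true] at this
        exact ⟨B', by simp [this]⟩
    rw [hAB, ← List.cons_append] at h
    have hL := h.of_append_left.solves_chainT
    have hrev : (B ++ [q]).reverse = q :: B.reverse := by simp
    have hR := h.of_append_right.reverse
    rw [hrev] at hR
    have hR := hR.solves_chainT
    rw [← hrev, armsVerts_reverse] at hR
    have hdisj : Disjoint (armsVerts (p :: A)) (armsVerts (B ++ [q])) := by
      rw [Set.disjoint_left]
      intro v hv hv'
      obtain ⟨A', a, hA'⟩ : ∃ A' a, p :: A = A' ++ [a] := by
        rcases List.eq_nil_or_concat (p :: A) with h | ⟨A', a, h⟩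
        · exact absurd h (by simp)
        · exact ⟨A', a, by simpa using h⟩
      obtain ⟨b, B', hB'⟩ : ∃ b B', B ++ [q] = b :: B' :=
        List.exists_cons_of_ne_nil (by simp)
      refine ((h.split A' a b B' (by rw [hA', hB']; simp)).2 v (by rwa [← hA']) v
        (by rwa [← hB'])).1 rfl
    have hset : ({p.1, q.1} : Set V) = {p.1} ∪ {q.1} := rfl
    have hvalid := hL.valid.merge hR.valid hL.subset hR.subset hdisj
    rw [← hSAB, ← armsVerts_append, List.cons_append, ← hAB, ← hset] at hvalid
    refine ⟨?_, hvalid, fun r hr => ?_, ?_⟩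
    · rintro v (rfl | rfl)
      exacts [mem_armsVerts_of_mem (by simp), mem_armsVerts_of_mem (by simp)]
    · rw [List.cons_append, ← hAB] at h
      -- The chosen split is compared with the one that the classic broadcast suggests; there, both
      -- chains are optimal.
      obtain ⟨A₀, B₀, h₀, hf₁, hf₂⟩ := h.exists_split_feasible hr
      rw [List.cons_append, List.cons.injEq] at h₀
      refine (hmin A₀ (B₀ ++ [q]) h₀.2 (by simp)).trans ?_
      rw [h₀.2, ← List.cons_append] at h
      have hrev₀ : (B₀ ++ [q]).reverse = q :: B₀.reverse := by simp
      have hR₀ := h.of_append_right.reverse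
      rw [hrev₀] at hR₀
      have hR₀ := hR₀.solves_chainT
      rw [← hrev₀, armsVerts_reverse] at hR₀
      rw [mergeT_length]
      exact max_le (h.of_append_left.solves_chainT.length_le_of_feasible r hf₁)
        (hR₀.length_le_of_feasible r hf₂)
    · have h₁ := hL.length_le
      have h₂ := hR.length_le
      rw [hSAB, mergeT_length, mergeT_flatten_length]
      omega
  -- Each of the two chains has one path call fewer than path vertices, which accounts for the
  -- summand 2.
  · have h₁ := chainT_flatten_length (p :: A) (by simp)
    have h₂ := chainT_flatten_length B.reverse (by simpa using hB)
    rw [armsCalls_reverse, List.length_reverse] at h₂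
    rw [hAB, ← List.cons_append, armsCalls_append, List.length_append, hSAB, mergeT_flatten_length]
    omega

/-- A bound for the cost of trying one edge of a path. -/
def splitCost (n : ℕ) : ℕ := 2 * ((n + 1) * (serveCost n + 1)) + 8 * n + 16

theorem IsArms.chainT_length_le {l : List (V × List (Job V))} (h : IsArms G l) :
    (chainT l).ret.length ≤ (chainT l).ret.flatten.length := by
  cases l with
  | nil => simp [chainT]
  | cons a l => exact h.solves_chainT.length_le

theorem bestSplitT_time_le (left right : List (V × List (Job V)))
    (h : IsArms G (left.reverse ++ right)) {n : ℕ} (hl : left ≠ [])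
    (hn : armsCalls (left.reverse ++ right) + (left.reverse ++ right).length ≤ n + 1) :
    (bestSplitT left right).time ≤ right.length * splitCost n + 1 := by
  induction right generalizing left with
  | nil => simp [bestSplitT]
  | cons q right ih =>
      have h₁ := h.of_append_left
      have h₂ := h.of_append_right.reverse
      have h₃ := ih (q :: left) (by simpa using h) (by simp) (by simpa using hn)
      rw [armsCalls_append, List.length_append] at hn
      have h₄ := h₁.chainT_time_le (n := n) (by omega)
      have h₅ := h₂.chainT_time_le (n := n) (by rw [armsCalls_reverse, List.length_reverse]; omega)
      have h₆ := chainT_flatten_length left.reverse (by simpa using hl)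
      have h₇ := chainT_flatten_length (q :: right).reverse (by simp)
      have h₈ := h₁.chainT_length_le
      have h₉ := h₂.chainT_length_le
      have h₁₀ := mergeT_time_le (chainT left.reverse).ret (chainT (q :: right).reverse).ret
      have h₁₁ := mergeT_length (chainT left.reverse).ret (chainT (q :: right).reverse).ret
      rw [armsCalls_reverse, List.length_reverse] at h₇
      have h₁₂ : left.reverse.length * (serveCost n + 1) ≤ (n + 1) * (serveCost n + 1) := by
        gcongr
        omega
      have h₁₃ : (q :: right).reverse.length * (serveCost n + 1) ≤
          (n + 1) * (serveCost n + 1) := by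
        gcongr
        rw [List.length_reverse]
        omega
      rw [List.length_reverse] at *
      -- The length of the best later scheme enters the cost of the comparison. The value 0 stands
      -- for the case that no later edge exists and nothing is compared.
      have hlen : (match (bestSplitT (q :: left) right).ret with
          | none => 0
          | some S => S.length) ≤ n := by
        by_cases hr : right = []
        · simp [hr, bestSplitT]
        · obtain ⟨S, hS, -, hmin⟩ := bestSplitT_spec (q :: left) right hr
          rw [hS]
          refine (hmin [] right rfl hr).trans ?_
          rw [List.append_nil, mergeT_length]
          have e₁ : IsArms G ((q :: left).reverse ++ right) := by simpa using h
          have e₂ := e₁.of_append_left.chainT_length_le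
          have e₃ := e₁.of_append_right.reverse.chainT_length_le
          have e₄ := chainT_flatten_length (q :: left).reverse (by simp)
          have e₅ := chainT_flatten_length right.reverse (by simpa using hr)
          rw [armsCalls_reverse, List.length_reverse] at e₄ e₅
          simp only [armsCalls, List.map_cons, List.sum_cons, List.length_cons, List.map_reverse,
            List.sum_reverse] at hn e₄ e₅
          omega
      simp only [bestSplitT, Timed.bind_time, tick_time, reverseT_time, reverseT_ret,
        List.append_nil, List.length_cons, splitCost] at *
      rw [Nat.add_mul, Nat.one_mul]
      cases hbest : (bestSplitT (q :: left) right).ret with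
      | none =>
          simp only [Timed.pure_time]
          omega
      | some S =>
          rw [hbest] at hlen
          simp only [Timed.bind_time, lengthT_time, leT_time] at hlen ⊢
          split <;> simp only [Timed.pure_time] <;> omega

end Arms


/-! ### Searching the graph -/

section Search

variable {V : Type}

/-- The edges of a graph that join two vertices in `U`. -/
def restrict (G : SimpleGraph V) (U : Set V) : SimpleGraph V where
  Adj x y := G.Adj x y ∧ x ∈ U ∧ y ∈ U
  symm := ⟨fun _ _ h => ⟨h.1.symm, h.2.2, h.2.1⟩⟩
  loopless := ⟨fun x h => G.loopless.irrefl x h.1⟩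

/-- The subgraph on the members of a list is connected (or empty). -/
def ConnectedOn (G : SimpleGraph V) (l : List V) : Prop :=
  ∀ a ∈ l, ∀ b ∈ l, (restrict G {x | x ∈ l}).Reachable a b

variable {G : SimpleGraph V}

theorem restrict_mono {U W : Set V} (h : U ⊆ W) : restrict G U ≤ restrict G W :=
  fun _ _ hxy => ⟨hxy.1, h hxy.2.1, h hxy.2.2⟩

theorem restrict_le (U : Set V) : restrict G U ≤ G := fun _ _ hxy => hxy.1

/-- Connectivity arguments are phrased through sets closed under adjacency, which avoids surgery on
walks. -/
theorem mem_of_reachable {H : SimpleGraph V} {X : Set V} (hX : ∀ x ∈ X, ∀ y, H.Adj x y → y ∈ X)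
    {a b : V} (ha : a ∈ X) (h : H.Reachable a b) : b ∈ X := by
  obtain ⟨p⟩ := h
  induction p with
  | nil => exact ha
  | cons hadj _ ih => exact ih (hX _ ha _ hadj)

theorem ConnectedOn.congr {l l' : List V} (h : ConnectedOn G l) (hl : ∀ x, x ∈ l ↔ x ∈ l') :
    ConnectedOn G l' := by
  have : {x | x ∈ l} = {x | x ∈ l'} := Set.ext hl
  intro a ha b hb
  rw [← this]
  exact h a ((hl a).2 ha) b ((hl b).2 hb)

variable {adj : V → V → Bool}

/-- Each step takes one vertex from the stack and only moves others onto it, so `stack.length +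
rest.length` drops by one and bounds the fuel needed. When `x` is taken, all its undiscovered
neighbours leave `rest` for good; hence no edge joins the two output lists. -/
theorem exploreT_spec (hadj : ∀ u v, adj u v = true ↔ G.Adj u v) (f : ℕ) (stack rest : List V)
    (hf : stack.length + rest.length ≤ f) :
    ((exploreT adj f stack rest).ret.1 ++ (exploreT adj f stack rest).ret.2).Perm
        (stack ++ rest) ∧
      (∀ x ∈ (exploreT adj f stack rest).ret.1, ∀ y ∈ (exploreT adj f stack rest).ret.2,
        ¬ G.Adj x y) ∧
      (∀ x ∈ stack, x ∈ (exploreT adj f stack rest).ret.1) ∧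
      (∀ y ∈ (exploreT adj f stack rest).ret.2, y ∈ rest) ∧
      ∀ x ∈ (exploreT adj f stack rest).ret.1, ∃ y ∈ stack,
        (restrict G {z | z ∈ (exploreT adj f stack rest).ret.1}).Reachable y x := by
  induction f generalizing stack rest with
  | zero =>
      have : stack = [] := List.length_eq_zero_iff.1 (by omega)
      subst this
      simp [exploreT]
  | succ f ih =>
      cases stack with
      | nil => simp [exploreT]
      | cons x stack =>
          simp only [exploreT, Timed.bind_ret, Timed.pure_ret, partitionT_ret, appendT_ret,
            adjT_ret]
          have hperm : (rest.filter (fun a => adj x a) ++ rest.filter fun a => !adj x a).Perm rest :=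
            List.filter_append_perm _ rest
          have hlen := hperm.length_eq
          rw [List.length_append] at hlen
          obtain ⟨h₁, h₂, h₃, h₄, h₅⟩ := ih (rest.filter (fun a => adj x a) ++ stack)
            (rest.filter fun a => !adj x a) (by
              simp only [List.length_cons, List.length_append] at *
              omega)
          generalize (exploreT adj f (rest.filter (fun a => adj x a) ++ stack)
            (rest.filter fun a => !adj x a)).ret = q at *
          have hmono : restrict G {z | z ∈ q.1} ≤ restrict G {z | z ∈ x :: q.1} :=
            restrict_mono fun z hz => List.mem_cons_of_mem _ hz
          refine ⟨?_, ?_, ?_, ?_, ?_⟩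
          · rw [List.cons_append, List.cons_append]
            refine List.Perm.cons x (h₁.trans ?_)
            rw [List.append_assoc]
            refine List.perm_append_comm_assoc _ _ _ |>.trans ?_
            exact hperm.append_left stack
          · intro y hy z hz
            rcases List.mem_cons.1 hy with rfl | hy
            · have := (List.mem_filter.1 (h₄ z hz)).2
              intro hyz
              rw [(hadj y z).2 hyz] at this
              simp at this
            · exact h₂ y hy z hz
          · intro y hy
            rcases List.mem_cons.1 hy with rfl | hy
            · simp
            · exact List.mem_cons_of_mem _ (h₃ y (by simp [hy]))
          · exact fun y hy => (List.mem_filter.1 (h₄ y hy)).1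
          · intro y hy
            rcases List.mem_cons.1 hy with rfl | hy
            · exact ⟨y, by simp, SimpleGraph.Reachable.refl y⟩
            · obtain ⟨z, hz, hzy⟩ := h₅ y hy
              have hzy := hzy.mono hmono
              rcases List.mem_append.1 hz with hz' | hz'
              · refine ⟨x, by simp, SimpleGraph.Reachable.trans (SimpleGraph.Adj.reachable ?_) hzy⟩
                exact ⟨(hadj x z).1 (List.mem_filter.1 hz').2, List.mem_cons_self,
                  List.mem_cons_of_mem _ (h₃ z hz)⟩
              · exact ⟨z, by simp [hz'], hzy⟩

theorem exploreT_time_le (f : ℕ) (stack rest : List V) {m : ℕ} (hm : rest.length ≤ m) :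
    (exploreT adj f stack rest).time ≤ f * (3 * m + 3) + 1 := by
  induction f generalizing stack rest with
  | zero => simp [exploreT]
  | succ f ih =>
      cases stack with
      | nil =>
          simp [exploreT]
      | cons x stack =>
          have h₁ := partitionT_time_le (adjT adj x) 1 rest fun _ _ => le_rfl
          have h₂ := ih (rest.filter (fun a => adj x a) ++ stack) (rest.filter fun a => !adj x a)
            (List.length_filter_le _ _ |>.trans hm)
          have h₃ := List.length_filter_le (fun a => adj x a) rest
          simp only [exploreT, Timed.bind_time, tick_time, partitionT_ret, appendT_time,
            appendT_ret, adjT_ret, Timed.pure_time]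
          nlinarith

theorem componentT_spec (hadj : ∀ u v, adj u v = true ↔ G.Adj u v) (v : V) (rest : List V) :
    ((componentT adj v rest).ret.1 ++ (componentT adj v rest).ret.2).Perm (v :: rest) ∧
      (∀ x ∈ (componentT adj v rest).ret.1, ∀ y ∈ (componentT adj v rest).ret.2, ¬ G.Adj x y) ∧
      v ∈ (componentT adj v rest).ret.1 ∧ ConnectedOn G (componentT adj v rest).ret.1 := by
  obtain ⟨h₁, h₂, h₃, -, h₅⟩ := exploreT_spec hadj (rest.length + 1) [v] rest (by simp; omega)
  simp only [componentT, Timed.bind_ret, lengthT_ret]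
  refine ⟨h₁, h₂, h₃ v (by simp), fun a ha b hb => ?_⟩
  obtain ⟨y, hy, hya⟩ := h₅ a ha
  obtain ⟨z, hz, hzb⟩ := h₅ b hb
  rw [List.mem_singleton.1 hy] at hya
  rw [List.mem_singleton.1 hz] at hzb
  exact hya.symm.trans hzb

/-- A bound for the cost of finding a connected component. -/
def componentCost (m : ℕ) : ℕ := (m + 1) * (3 * m + 3) + m + 3

theorem componentT_time_le (v : V) (rest : List V) {m : ℕ} (hm : rest.length ≤ m) :
    (componentT adj v rest).time ≤ componentCost m := by
  have h := exploreT_time_le (adj := adj) (rest.length + 1) [v] rest hm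
  have h' : (rest.length + 1) * (3 * m + 3) ≤ (m + 1) * (3 * m + 3) := by gcongr
  simp only [componentT, Timed.bind_time, tick_time, lengthT_time, lengthT_ret, componentCost]
  omega

theorem componentsAuxT_spec (hadj : ∀ u v, adj u v = true ↔ G.Adj u v) (f : ℕ) (l : List V)
    (hf : l.length ≤ f) :
    (componentsAuxT adj f l).ret.flatten.Perm l ∧
      (∀ D ∈ (componentsAuxT adj f l).ret, D ≠ [] ∧ ConnectedOn G D) ∧
      (componentsAuxT adj f l).ret.Pairwise fun D D' => ∀ x ∈ D, ∀ y ∈ D', ¬ G.Adj x y := by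
  induction f generalizing l with
  | zero =>
      have : l = [] := List.length_eq_zero_iff.1 (by omega)
      subst this
      simp [componentsAuxT]
  | succ f ih =>
      cases l with
      | nil => simp [componentsAuxT]
      | cons v rest =>
          obtain ⟨h₁, h₂, h₃, h₄⟩ := componentT_spec hadj v rest
          simp only [componentsAuxT, Timed.bind_ret, Timed.pure_ret]
          generalize (componentT adj v rest).ret = q at *
          have hlen := h₁.length_eq
          have hpos := List.length_pos_of_mem h₃
          simp only [List.length_append, List.length_cons] at hlen hf
          obtain ⟨h₅, h₆, h₇⟩ := ih q.2 (by omega)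
          refine ⟨?_, ?_, List.pairwise_cons.2 ⟨fun D hD x hx y hy => ?_, h₇⟩⟩
          · rw [List.flatten_cons]
            exact (h₅.append_left q.1).trans h₁
          · intro D hD
            rcases List.mem_cons.1 hD with rfl | hD
            · exact ⟨List.ne_nil_of_mem h₃, h₄⟩
            · exact h₆ D hD
          · exact h₂ x hx y (h₅.subset (List.mem_flatten.2 ⟨D, hD, hy⟩))

theorem componentsAuxT_time_le (hadj : ∀ u v, adj u v = true ↔ G.Adj u v) (f : ℕ) (l : List V)
    {m : ℕ} (hm : l.length ≤ m) :
    (componentsAuxT adj f l).time ≤ f * (componentCost m + 1) + 1 := by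
  induction f generalizing l with
  | zero => simp [componentsAuxT]
  | succ f ih =>
      cases l with
      | nil => simp [componentsAuxT]
      | cons v rest =>
          rw [List.length_cons] at hm
          have hlen := (componentT_spec hadj v rest).1.length_eq
          have hpos := List.length_pos_of_mem (componentT_spec hadj v rest).2.2.1
          simp only [List.length_append, List.length_cons] at hlen
          have h₁ := componentT_time_le (adj := adj) v rest (m := m) (by omega)
          have h₂ := ih (componentT adj v rest).ret.2 (by omega)
          simp only [componentsAuxT, Timed.bind_time, tick_time, Timed.pure_time]
          linarith

theorem componentsT_spec (hadj : ∀ u v, adj u v = true ↔ G.Adj u v) (l : List V) :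
    (componentsT adj l).ret.flatten.Perm l ∧
      (∀ D ∈ (componentsT adj l).ret, D ≠ [] ∧ ConnectedOn G D) ∧
      (componentsT adj l).ret.Pairwise fun D D' => ∀ x ∈ D, ∀ y ∈ D', ¬ G.Adj x y := by
  simpa [componentsT] using componentsAuxT_spec hadj l.length l le_rfl

/-- A bound for the cost of finding all connected components. -/
def componentsCost (m : ℕ) : ℕ := m * (componentCost m + 1) + m + 3

theorem componentsT_time_le (hadj : ∀ u v, adj u v = true ↔ G.Adj u v) (l : List V)
    {m : ℕ} (hm : l.length ≤ m) : (componentsT adj l).time ≤ componentsCost m := by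
  have h := componentsAuxT_time_le hadj l.length l hm
  have h' : l.length * (componentCost m + 1) ≤ m * (componentCost m + 1) := by gcongr
  simp only [componentsT, Timed.bind_time, tick_time, lengthT_time, lengthT_ret, componentsCost]
  omega

theorem componentsT_length_le (hadj : ∀ u v, adj u v = true ↔ G.Adj u v) (l : List V) :
    (componentsT adj l).ret.length ≤ l.length := by
  obtain ⟨h₁, h₂, -⟩ := componentsT_spec hadj l
  rw [← h₁.length_eq, List.length_flatten]
  have : ((componentsT adj l).ret.map fun _ => 1).sum ≤
      ((componentsT adj l).ret.map List.length).sum :=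
    List.sum_le_sum fun D hD => List.length_pos_iff.2 (h₂ D hD).1
  simpa using this

variable [DecidableEq V]

/-- A bound for the cost of finding one edge of a path. -/
def pathCost (m : ℕ) : ℕ := componentCost m + 10 * m + 8

theorem mem_filter_notMem_singleton {l : List V} {u x : V} :
    x ∈ l.filter (fun v => v ∉ [u]) ↔ x ∈ l ∧ x ≠ u := by
  simp

/-- After `v` is deleted, the search continues in the component of `u`, at a neighbour `w` of `v`.
As `v` is outside of this component, the path never returns to it; as `w` is removed as well, the
fuel suffices. Nothing is claimed about the choice of the path, since in the application every path
will do. -/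
theorem pathT_spec (hadj : ∀ u v, adj u v = true ↔ G.Adj u v) (f : ℕ) (v u : V) (A : List V)
    (hf : A.length ≤ f) (hA : A.Nodup) (hv : v ∉ A) (hu : u ∈ v :: A)
    (hc : ConnectedOn G (v :: A)) :
    (∃ l, (pathT adj f v u A).ret = v :: l) ∧
      (pathT adj f v u A).ret.getLast? = some u ∧
      (pathT adj f v u A).ret.IsChain G.Adj ∧ (pathT adj f v u A).ret.Nodup ∧
      ∀ x ∈ (pathT adj f v u A).ret, x ∈ v :: A := by
  induction f generalizing v A with
  | zero =>
      have : A = [] := List.length_eq_zero_iff.1 (by omega)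
      subst this
      have : u = v := by simpa using hu
      subst this
      simp [pathT]
  | succ f ih =>
      by_cases hvu : v = u
      · subst hvu
        simp [pathT]
      · have huA : u ∈ A := (List.mem_cons.1 hu).resolve_left (Ne.symm hvu)
        simp only [pathT, Timed.bind_ret, eqT_ret, hvu, decide_false, Bool.false_eq_true, if_false,
          diffT_ret, partitionT_ret, adjT_ret]
        obtain ⟨h₁, h₂, h₃, h₄⟩ := componentT_spec hadj u (A.filter fun v => v ∉ [u])
        generalize (componentT adj u (A.filter fun v => v ∉ [u])).ret = K at *
        have hmem : ∀ x, x ∈ A ↔ x ∈ K.1 ∨ x ∈ K.2 := by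
          intro x
          rw [← List.mem_append, h₁.mem_iff, List.mem_cons, mem_filter_notMem_singleton]
          by_cases hx : x = u
          · simp [hx, huA]
          · simp [hx]
        have hnd : (K.1 ++ K.2).Nodup := by
          rw [h₁.nodup_iff, List.nodup_cons, mem_filter_notMem_singleton]
          exact ⟨fun h => h.2 rfl, hA.filter _⟩
        have hlen : K.1.length ≤ A.length := by
          have hsub : K.1 ⊆ A := fun x hx => (hmem x).2 (Or.inl hx)
          exact (List.subperm_of_subset (List.nodup_append.1 hnd).1 hsub).length_le
        -- Otherwise the component of `u` would be closed under adjacency in `v :: A`, against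
        -- connectedness.
        have hex : ∃ w ∈ K.1, G.Adj v w := by
          by_contra! hno
          have : v ∈ {x | x ∈ K.1} := by
            refine mem_of_reachable (fun x hx y hxy => ?_) h₃ (hc u hu v List.mem_cons_self)
            rcases List.mem_cons.1 hxy.2.2 with rfl | hy
            · exact absurd hxy.1.symm (hno x hx)
            · exact ((hmem y).1 hy).resolve_right fun hy => h₂ x hx y hy hxy.1
          exact hv ((hmem v).2 (Or.inl this))
        cases hN : K.1.filter fun a => adj v a with
        | nil =>
            obtain ⟨w, hw, hvw⟩ := hex
            have : w ∈ K.1.filter fun a => adj v a := List.mem_filter.2 ⟨hw, (hadj v w).2 hvw⟩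
            rw [hN] at this
            exact absurd this (by simp)
        | cons w N =>
            have hw : w ∈ K.1.filter fun a => adj v a := by rw [hN]; simp
            obtain ⟨hw, hvw⟩ := List.mem_filter.1 hw
            have hvw := (hadj v w).1 hvw
            simp only [Timed.bind_ret, Timed.pure_ret, diffT_ret]
            have hmem' : ∀ x, x ∈ K.1 ↔ x ∈ w :: K.1.filter fun v => v ∉ [w] := by
              intro x
              rw [List.mem_cons, mem_filter_notMem_singleton]
              by_cases hx : x = w
              · simp [hx, hw]
              · simp [hx]
            have hwK : w ∉ K.1.filter fun v => v ∉ [w] := by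
              rw [mem_filter_notMem_singleton]
              exact fun h => h.2 rfl
            have hlen' : (K.1.filter fun v => v ∉ [w]).length < K.1.length :=
              List.length_filter_lt_length_iff_exists.2 ⟨w, hw, by simp⟩
            obtain ⟨⟨l, h₅⟩, h₆, h₇, h₈, h₉⟩ := ih w (K.1.filter fun v => v ∉ [w])
              (by omega) ((List.nodup_append.1 hnd).1.filter _) hwK ((hmem' u).1 h₃)
              (h₄.congr hmem')
            generalize (pathT adj f w u (K.1.filter fun v => v ∉ [w])).ret = P at *
            refine ⟨⟨P, rfl⟩, ?_, ?_, ?_, ?_⟩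
            · rw [h₅] at h₆ ⊢
              rw [List.getLast?_cons_cons]
              exact h₆
            · rw [h₅] at h₇ ⊢
              exact List.isChain_cons_cons.2 ⟨hvw, h₇⟩
            · refine List.nodup_cons.2 ⟨fun hvP => ?_, h₈⟩
              exact hv ((hmem v).2 (Or.inl ((hmem' v).2 (h₉ v hvP))))
            · intro x hx
              rcases List.mem_cons.1 hx with rfl | hx
              · simp
              · exact List.mem_cons_of_mem _ ((hmem x).2 (Or.inl ((hmem' x).2 (h₉ x hx))))

theorem pathT_time_le (hadj : ∀ u v, adj u v = true ↔ G.Adj u v) (f : ℕ) (v u : V) (A : List V)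
    {m : ℕ} (hm : A.length + 1 ≤ m) : (pathT adj f v u A).time ≤ f * pathCost m + 1 := by
  induction f generalizing v A with
  | zero => simp [pathT]
  | succ f ih =>
      by_cases hvu : v = u
      · simp [pathT, hvu, pathCost]
        nlinarith
      · simp only [pathT, Timed.bind_time, tick_time, eqT_time, eqT_ret, hvu, decide_false,
          Bool.false_eq_true, if_false, diffT_ret, partitionT_ret, adjT_ret]
        have h₁ := diffT_time_le A [u]
        have h₂ := List.length_filter_le (fun v => decide (v ∉ [u])) A
        have h₃ := componentT_time_le (adj := adj) u (A.filter fun v => v ∉ [u]) (m := m) (by omega)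
        have h₄ := (componentT_spec hadj u (A.filter fun v => v ∉ [u])).1.length_eq
        generalize componentT adj u (A.filter fun v => v ∉ [u]) = K at *
        have h₅ := partitionT_time_le (adjT adj v) 1 K.ret.1 fun _ _ => le_rfl
        simp only [List.length_append, List.length_cons, List.length_nil] at h₁ h₄
        have hK : K.ret.1.length ≤ m := by omega
        cases hN : K.ret.1.filter fun a => adj v a with
        | nil =>
            simp only [Timed.pure_time]
            unfold pathCost
            nlinarith
        | cons w N =>
            have hw : w ∈ K.ret.1.filter fun a => adj v a := by rw [hN]; simp
            have h₆ := diffT_time_le K.ret.1 [w]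
            have h₇ : (K.ret.1.filter fun v => v ∉ [w]).length < K.ret.1.length :=
              List.length_filter_lt_length_iff_exists.2 ⟨w, (List.mem_filter.1 hw).1, by simp⟩
            have h₈ := ih w (K.ret.1.filter fun v => v ∉ [w]) (by omega)
            simp only [List.length_cons, List.length_nil] at h₆
            simp only [Timed.bind_time, Timed.pure_time, diffT_ret]
            unfold pathCost at *
            rw [Nat.add_mul, Nat.one_mul]
            omega

end Search


/-! ### The structure of cactus graphs -/

section Cactus

variable {V : Type} {G : SimpleGraph V}

/-- The closed walk through `s` and a walk between two of its neighbours. -/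
def closeUp {s a b : V} (hsa : G.Adj s a) (p : G.Walk a b) (hbs : G.Adj b s) : G.Walk s s :=
  SimpleGraph.Walk.cons hsa (p.concat hbs)

/-- The hypothesis `a ≠ b` excludes the closed walk that traverses one edge back and forth. -/
theorem isCycle_closeUp {s a b : V} (hsa : G.Adj s a) (p : G.Walk a b) (hbs : G.Adj b s)
    (hp : p.IsPath) (hs : s ∉ p.support) (hab : a ≠ b) : (closeUp hsa p hbs).IsCycle := by
  rw [closeUp, SimpleGraph.Walk.cons_isCycle_iff, SimpleGraph.Walk.concat_isPath_iff]
  refine ⟨⟨hp, hs⟩, ?_⟩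
  rw [SimpleGraph.Walk.edges_concat, List.concat_eq_append, List.mem_append, List.mem_singleton]
  rintro (h | h)
  · exact hs (p.fst_mem_support_of_mem_edges h)
  · rcases Sym2.eq_iff.1 h with ⟨h₁, -⟩ | ⟨-, h₂⟩
    · exact hbs.ne h₁.symm
    · exact hab h₂

theorem mem_edges_closeUp {s a b : V} (hsa : G.Adj s a) (p : G.Walk a b) (hbs : G.Adj b s)
    {e : Sym2 V} :
    e ∈ (closeUp hsa p hbs).edges ↔ e = s(s, a) ∨ e ∈ p.edges ∨ e = s(b, s) := by
  rw [closeUp, SimpleGraph.Walk.edges_cons, SimpleGraph.Walk.edges_concat,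
    List.concat_eq_append, List.mem_cons, List.mem_append, List.mem_singleton]

/-- Both cycles contain the edge from `s` to `a`, hence two common vertices. In a cactus they must
then be the same cycle, with the same edges. -/
theorem IsCactus.mem_edges_closeUp_iff (hG : IsCactus G) {s a b c : V} (hsa : G.Adj s a)
    {p : G.Walk a b} (hbs : G.Adj b s) {q : G.Walk a c} (hcs : G.Adj c s) (hp : p.IsPath)
    (hps : s ∉ p.support) (hq : q.IsPath) (hqs : s ∉ q.support) (hab : a ≠ b) (hac : a ≠ c)
    (e : Sym2 V) : e ∈ (closeUp hsa p hbs).edges ↔ e ∈ (closeUp hsa q hcs).edges := by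
  have heq : (closeUp hsa p hbs).toSubgraph = (closeUp hsa q hcs).toSubgraph := by
    by_contra hne
    have := hG.2 _ _ (isCycle_closeUp hsa p hbs hp hps hab)
      (isCycle_closeUp hsa q hcs hq hqs hac) hne
    refine hsa.ne (this ⟨by simp [closeUp], by simp [closeUp]⟩ ⟨?_, ?_⟩) <;>
      simp [closeUp, SimpleGraph.Walk.support_concat]
  rw [← SimpleGraph.Walk.mem_edges_toSubgraph, heq, SimpleGraph.Walk.mem_edges_toSubgraph]

theorem mem_of_mem_support {H : SimpleGraph V} {U : Set V} (hH : H ≤ restrict G U) {a b x : V}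
    (ha : a ∈ U) (p : H.Walk a b) (hx : x ∈ p.support) : x ∈ U := by
  classical
  exact mem_of_reachable (H := H) (fun y _ z hyz => (hH hyz).2.2) ha ⟨p.takeUntil x hx⟩

/-- Vertices that are joined in a part of a graph are joined by a path there. -/
theorem exists_isPath_of_reachable {H : SimpleGraph V} {U : Set V} (hH : H ≤ restrict G U)
    {a b : V} (ha : a ∈ U) (h : H.Reachable a b) :
    ∃ p : G.Walk a b, p.IsPath ∧ (∀ x ∈ p.support, x ∈ U) ∧ ∀ e ∈ p.edges, e ∈ H.edgeSet := by
  obtain ⟨p, hp⟩ := h.exists_isPath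
  have hle : H ≤ G := hH.trans (restrict_le U)
  refine ⟨p.mapLe hle, (SimpleGraph.Walk.isPath_mapLe hle).2 hp, fun x hx => ?_, fun e he => ?_⟩
  · rw [SimpleGraph.Walk.support_mapLe_eq_support] at hx
    exact mem_of_mem_support hH ha p hx
  · rw [SimpleGraph.Walk.edges_mapLe_eq_edges] at he
    exact p.edges_subset_edgeSet he

/-- In a cactus, a connected part of the graph contains at most two neighbours of a vertex outside
of it. -/
theorem IsCactus.eq_of_adj (hG : IsCactus G) {D : List V} (hD : ConnectedOn G D) {s a b c : V}
    (hs : s ∉ D) (ha : a ∈ D) (hb : b ∈ D) (hc : c ∈ D) (hsa : G.Adj s a) (hsb : G.Adj s b)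
    (hsc : G.Adj s c) (hab : a ≠ b) (hac : a ≠ c) : b = c := by
  obtain ⟨p, hp, hpD, -⟩ := exists_isPath_of_reachable (U := {x | x ∈ D}) le_rfl ha (hD a ha b hb)
  obtain ⟨q, hq, hqD, -⟩ := exists_isPath_of_reachable (U := {x | x ∈ D}) le_rfl ha (hD a ha c hc)
  have hqs : s ∉ q.support := fun h => hs (hqD s h)
  have h := (hG.mem_edges_closeUp_iff hsa hsb.symm hsc.symm hp (fun h => hs (hpD s h)) hq hqs
    hab hac s(b, s)).1 ((mem_edges_closeUp _ _ _).2 (Or.inr (Or.inr rfl)))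
  -- The edge from `b` to `s` lies on the cycle through `c`, whose only edges at `s` lead to `a` and
  -- `c`.
  rcases (mem_edges_closeUp _ _ _).1 h with h | h | h
  · rcases Sym2.eq_iff.1 h with ⟨h₁, -⟩ | ⟨h₁, -⟩
    · exact absurd h₁ hsb.ne'
    · exact absurd h₁.symm hab
  · exact absurd (q.snd_mem_support_of_mem_edges h) hqs
  · rcases Sym2.eq_iff.1 h with ⟨h₁, -⟩ | ⟨h₁, -⟩
    · exact h₁
    · exact absurd h₁ hsb.ne'

/-- Fits `SimpleGraph.Walk.edges_eq_zipWith_support`, which lists the edges of a walk as consecutive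
pairs of its support. -/
theorem mem_zipWith_tail {α : Type} (A B : List α) (a b : α) :
    s(a, b) ∈ List.zipWith (s(·, ·)) (A ++ a :: b :: B) (A ++ a :: b :: B).tail := by
  induction A with
  | nil => simp
  | cons c A ih =>
      cases A with
      | nil => simp
      | cons d A =>
          simp only [List.cons_append, List.tail_cons, List.zipWith_cons_cons, List.mem_cons] at *
          exact Or.inr ih

/-- In a cactus, the edges of a path between two neighbours of an outer vertex are cut-edges. -/
theorem IsCactus.not_reachable_deleteEdges (hG : IsCactus G) {U : Set V} {x s₁ s₂ : V}
    (hx : x ∉ U) (h₁ : G.Adj x s₁) (h₂ : G.Adj x s₂) (hne : s₁ ≠ s₂) {A B : List V} {a b : V}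
    (hPU : ∀ v ∈ A ++ a :: b :: B, v ∈ U) (hchain : (A ++ a :: b :: B).IsChain G.Adj)
    (hnd : (A ++ a :: b :: B).Nodup) (hhead : (A ++ a :: b :: B).head? = some s₁)
    (hlast : (A ++ a :: b :: B).getLast? = some s₂) :
    ¬ ((restrict G U).deleteEdges {s(a, b)}).Reachable s₁ s₂ := by
  intro hr
  have hnil : A ++ a :: b :: B ≠ [] := by simp
  have e₁ : (A ++ a :: b :: B).head hnil = s₁ := by
    rw [List.head?_eq_some_head hnil] at hhead
    exact Option.some.inj hhead
  have e₂ : (A ++ a :: b :: B).getLast hnil = s₂ := by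
    rw [List.getLast?_eq_some_getLast hnil] at hlast
    exact Option.some.inj hlast
  have hs₁ : s₁ ∈ U := hPU s₁ (e₁ ▸ List.head_mem hnil)
  obtain ⟨p, hp⟩ : ∃ p : G.Walk s₁ s₂, p.support = A ++ a :: b :: B := by
    rw [← e₁, ← e₂]
    exact ⟨SimpleGraph.Walk.ofSupport _ hnil hchain, SimpleGraph.Walk.support_ofSupport _ _⟩
  -- A second path that avoids the edge `a b` would close up at `x` to another cycle through the
  -- edge from `x` to `s₁`.
  obtain ⟨q, hq, hqU, hqe⟩ := exists_isPath_of_reachable (SimpleGraph.deleteEdges_le _) hs₁ hr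
  have hpx : x ∉ p.support := fun h => hx (hPU x (hp ▸ h))
  have he : s(a, b) ∈ p.edges := by
    rw [SimpleGraph.Walk.edges_eq_zipWith_support, hp]
    exact mem_zipWith_tail A B a b
  have hab : a ∈ U ∧ b ∈ U := ⟨hPU a (by simp), hPU b (by simp)⟩
  have h := (hG.mem_edges_closeUp_iff h₁ h₂.symm h₂.symm
    ((SimpleGraph.Walk.isPath_def p).2 (hp ▸ hnd)) hpx hq
    (fun h => hx (hqU x h)) hne hne s(a, b)).1 ((mem_edges_closeUp _ _ _).2 (Or.inr (Or.inl he)))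
  rcases (mem_edges_closeUp _ _ _).1 h with h | h | h
  · rcases Sym2.eq_iff.1 h with ⟨h, -⟩ | ⟨-, h⟩
    exacts [hx (h ▸ hab.1), hx (h ▸ hab.2)]
  · have := hqe _ h
    rw [SimpleGraph.mem_edgeSet, SimpleGraph.deleteEdges_adj] at this
    exact this.2 rfl
  · rcases Sym2.eq_iff.1 h with ⟨-, h⟩ | ⟨h, -⟩
    exacts [hx (h ▸ hab.2), hx (h ▸ hab.1)]

theorem reachable_of_isChain {H : SimpleGraph V} {a : V} {l : List V}
    (h : (a :: l).IsChain H.Adj) : ∀ x ∈ a :: l, H.Reachable a x := by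
  induction l generalizing a with
  | nil =>
      intro x hx
      rw [List.mem_singleton.1 hx]
  | cons b l ih =>
      obtain ⟨h₁, h₂⟩ := List.isChain_cons_cons.1 h
      intro x hx
      rcases List.mem_cons.1 hx with rfl | hx
      · exact SimpleGraph.Reachable.refl x
      · exact h₁.reachable.trans (ih h₂ x hx)

/-- A stretch of the path before the edge misses `b`, one after it misses `a`; neither can use the
deleted edge. -/
theorem isChain_restrict_deleteEdges {U : Set V} {a b : V} {l : List V} (h : l.IsChain G.Adj)
    (hU : ∀ v ∈ l, v ∈ U) (hl : a ∉ l ∨ b ∉ l) :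
    l.IsChain ((restrict G U).deleteEdges {s(a, b)}).Adj := by
  refine (List.isChain_iff_forall_rel_of_append_cons_cons.2 ?_)
  rintro x y l₁ l₂ rfl
  have hxy := List.isChain_iff_forall_rel_of_append_cons_cons.1 h rfl
  rw [SimpleGraph.deleteEdges_adj]
  refine ⟨⟨hxy, hU x (by simp), hU y (by simp)⟩, fun he => ?_⟩
  rcases Sym2.eq_iff.1 (Set.mem_singleton_iff.1 he) with ⟨rfl, rfl⟩ | ⟨rfl, rfl⟩ <;> simp at hl

/-- In a connected graph, every vertex outside of a non-empty set hangs on a vertex of this set. -/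
theorem ConnectedOn.exists_attached {U P R : List V} (h : ConnectedOn G U) {p₀ v : V}
    (hR : ∀ x, x ∈ R ↔ x ∈ U ∧ x ∉ P) (hp₀ : p₀ ∈ P) (hp₀U : p₀ ∈ U) (hv : v ∈ R) :
    ∃ p ∈ P, ∃ y ∈ R, G.Adj p y ∧ (restrict G {x | x ∈ R}).Reachable y v := by
  by_contra! hno
  -- The vertices joined to `v` inside `R` would form a set closed under adjacency in `U`, so that
  -- `p₀` could not be reached.
  have := mem_of_reachable
    (X := {x | x ∈ R ∧ (restrict G {x | x ∈ R}).Reachable x v}) (fun x hx y hxy => ?_)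
    ⟨hv, SimpleGraph.Reachable.refl v⟩ (h v ((hR v).1 hv).1 p₀ hp₀U)
  · exact ((hR p₀).1 this.1).2 hp₀
  · have hyR : y ∈ R := by
      by_contra hyR
      have hyP : y ∈ P := by
        by_contra hyP
        exact hyR ((hR y).2 ⟨hxy.2.2, hyP⟩)
      exact hno y hyP x hx.1 hxy.1.symm hx.2
    exact ⟨hyR, SimpleGraph.Reachable.trans
      (SimpleGraph.Adj.reachable ⟨hxy.1.symm, hyR, hx.1⟩) hx.2⟩

variable [DecidableEq V]

/-- The vertices of a path between two neighbours of an outer vertex, with their jobs outside of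
the path, split the graph at each edge of the path. -/
theorem IsCactus.isArms (hG : IsCactus G) {U P R : List V} {x s₁ s₂ : V}
    (hx : x ∉ U) (h₁ : G.Adj x s₁) (h₂ : G.Adj x s₂) (hne : s₁ ≠ s₂)
    (hPU : ∀ v ∈ P, v ∈ U) (hchain : P.IsChain G.Adj) (hnd : P.Nodup)
    (hhead : P.head? = some s₁) (hlast : P.getLast? = some s₂)
    (hR : ∀ x, x ∈ R ↔ x ∈ U ∧ x ∉ P) (js : V → List (Job V))
    (hjs : ∀ p ∈ P, AreJobs G p (js p) ∧ ∀ v, (∃ j ∈ js p, v ∈ jobVerts j) ↔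
      v ∈ R ∧ ∃ y ∈ R, G.Adj p y ∧ (restrict G {x | x ∈ R}).Reachable y v) :
    IsArms G (P.map fun p => (p, js p)) := by
  refine ⟨fun a ha => ?_, fun A a b B hl => ?_⟩
  · obtain ⟨p, hp, rfl⟩ := List.mem_map.1 ha
    exact (hjs p hp).1
  · have hP : P = A.map Prod.fst ++ a.1 :: b.1 :: B.map Prod.fst := by
      have := congrArg (List.map Prod.fst) hl
      simpa [Function.comp_def] using this
    have harm : ∀ c ∈ A ++ a :: b :: B, c.1 ∈ P ∧ c = (c.1, js c.1) := by
      intro c hc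
      rw [← hl] at hc
      obtain ⟨p, hp, rfl⟩ := List.mem_map.1 hc
      exact ⟨hp, rfl⟩
    have haP : a.1 ∈ P := (harm a (by simp)).1
    have hbP : b.1 ∈ P := (harm b (by simp)).1
    -- All separation properties follow from this: without the edge, `s₁` and `s₂` are not joined in
    -- `U`.
    have hnr : ¬ ((restrict G {x | x ∈ U}).deleteEdges {s(a.1, b.1)}).Reachable s₁ s₂ :=
      hG.not_reachable_deleteEdges (B := B.map Prod.fst) (A := A.map Prod.fst) hx h₁ h₂ hne
        (hP ▸ hPU) (hP ▸ hchain) (hP ▸ hnd) (hP ▸ hhead) (hP ▸ hlast)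
    have hRP : ∀ y ∈ R, y ≠ a.1 ∧ y ≠ b.1 := fun y hy =>
      ⟨fun h => ((hR y).1 hy).2 (h ▸ haP), fun h => ((hR y).1 hy).2 (h ▸ hbP)⟩
    -- Both ends of the deleted edge are on the path, so edges with an end in `R` survive the
    -- deletion.
    have hHadj : ∀ y z, G.Adj y z → y ∈ U → z ∈ R →
        ((restrict G {x | x ∈ U}).deleteEdges {s(a.1, b.1)}).Adj y z := by
      intro y z hyz hy hz
      rw [SimpleGraph.deleteEdges_adj]
      refine ⟨⟨hyz, hy, ((hR z).1 hz).1⟩, fun he => ?_⟩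
      rcases Sym2.eq_iff.1 (Set.mem_singleton_iff.1 he) with ⟨-, h⟩ | ⟨-, h⟩
      exacts [(hRP z hz).2 h, (hRP z hz).1 h]
    have hle : restrict G {x | x ∈ R} ≤
        (restrict G {x | x ∈ U}).deleteEdges {s(a.1, b.1)} := fun y z hyz =>
      hHadj y z hyz.1 ((hR y).1 hyz.2.1).1 hyz.2.2
    have harmReach : ∀ c ∈ A ++ a :: b :: B, ∀ y ∈ armVerts c,
        ((restrict G {x | x ∈ U}).deleteEdges {s(a.1, b.1)}).Reachable c.1 y := by
      rintro c hc y (rfl | hy)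
      · exact SimpleGraph.Reachable.refl _
      · obtain ⟨hcP, hceq⟩ := harm c hc
        rw [hceq] at hy
        obtain ⟨hyR, z, hz, hcz, hzy⟩ := ((hjs c.1 hcP).2 y).1 hy
        exact (hHadj c.1 z hcz (hPU c.1 hcP) hz).reachable.trans (hzy.mono hle)
    rw [hP] at hnd hchain
    have hL : ∀ y ∈ armsVerts (A ++ [a]),
        ((restrict G {x | x ∈ U}).deleteEdges {s(a.1, b.1)}).Reachable s₁ y := by
      rintro y ⟨c, hc, hy⟩
      refine SimpleGraph.Reachable.trans ?_ (harmReach c (by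
        rw [List.append_cons]
        exact List.mem_append_left _ hc) y hy)
      rw [List.append_cons] at hnd hchain
      have hch := isChain_restrict_deleteEdges (a := a.1) (b := b.1) (U := {x | x ∈ U})
        hchain.left_of_append (fun v hv => hPU v (by
          rw [hP, List.append_cons]
          exact List.mem_append_left _ hv))
        (Or.inr fun hb => (List.nodup_append.1 hnd).2.2 _ hb _ List.mem_cons_self rfl)
      have hcm : c.1 ∈ A.map Prod.fst ++ [a.1] := by
        have := List.mem_map_of_mem (f := Prod.fst) hc
        simpa using this
      cases hAl : A.map Prod.fst ++ [a.1] with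
      | nil => simp at hAl
      | cons d l =>
          have hd : d = s₁ := by
            rw [hP, List.append_cons, hAl] at hhead
            simpa using hhead
          subst hd
          rw [hAl] at hch hcm
          exact reachable_of_isChain hch _ hcm
    have hRt : ∀ y ∈ armsVerts (b :: B),
        ((restrict G {x | x ∈ U}).deleteEdges {s(a.1, b.1)}).Reachable y s₂ := by
      rintro y ⟨c, hc, hy⟩
      refine SimpleGraph.Reachable.trans (harmReach c (by
        exact List.mem_append_right _ (List.mem_cons_of_mem _ hc)) y hy).symm ?_
      rw [List.append_cons] at hnd hchain
      have hch := isChain_restrict_deleteEdges (a := a.1) (b := b.1) (U := {x | x ∈ U})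
        hchain.right_of_append (fun v hv => hPU v (by
          rw [hP, List.append_cons]
          exact List.mem_append_right _ hv))
        (Or.inl fun hb => (List.nodup_append.1 hnd).2.2 a.1 (by simp) _ hb rfl)
      have hreach := reachable_of_isChain hch
      have hcm : c.1 ∈ b.1 :: B.map Prod.fst := by
        have := List.mem_map_of_mem (f := Prod.fst) hc
        simpa using this
      refine (hreach _ hcm).symm.trans (hreach _ ?_)
      rw [hP, List.append_cons, List.getLast?_append] at hlast
      have : (b.1 :: B.map Prod.fst).getLast? = some s₂ := by
        simpa [List.getLast?_eq_some_getLast (List.cons_ne_nil b.1 (B.map Prod.fst))] using hlast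
      exact List.mem_of_getLast? this
    have hab : G.Adj a.1 b.1 := List.isChain_iff_forall_rel_of_append_cons_cons.1 hchain rfl
    have hmemU : ∀ c ∈ A ++ a :: b :: B, ∀ y ∈ armVerts c, y ∈ U := by
      rintro c hc y (rfl | hy)
      · exact hPU _ (harm c hc).1
      · obtain ⟨hcP, hceq⟩ := harm c hc
        rw [hceq] at hy
        exact ((hR y).1 (((hjs c.1 hcP).2 y).1 hy).1).1
    -- Everything before the edge is joined to `s₁` without it, everything after it to `s₂`. A
    -- common vertex or a second edge across would therefore join `s₁` to `s₂`.
    refine ⟨hab, fun y hy z hz => ⟨?_, fun hyz => ?_⟩⟩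
    · rintro rfl
      exact hnr ((hL y hy).trans (hRt y hz))
    · by_cases he : s(y, z) = s(a.1, b.1)
      · rcases Sym2.eq_iff.1 he with h | ⟨h, -⟩
        · exact h
        · refine absurd ((hL y hy).trans (hRt y ?_)) hnr
          rw [h]
          exact mem_armsVerts_of_mem (by simp)
      · refine absurd (((hL y hy).trans (SimpleGraph.Adj.reachable ?_)).trans (hRt z hz)) hnr
        obtain ⟨c, hc, hyc⟩ := hy
        obtain ⟨d, hd, hzd⟩ := hz
        rw [SimpleGraph.deleteEdges_adj]
        refine ⟨⟨hyz, hmemU c ?_ y hyc, hmemU d ?_ z hzd⟩, he⟩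
        · rw [List.append_cons]
          exact List.mem_append_left _ hc
        · exact List.mem_append_right _ (List.mem_cons_of_mem _ hd)

end Cactus


/-! ### Correctness and cost of Cactus Broadcaster -/

section Broadcaster

/-- A bound for the cost of finding the jobs of a vertex, without the recursive calls. -/
def jobsCost (n : ℕ) : ℕ := componentsCost n + n * (2 * n + 2) + n + 2

/-- A bound for the cost of a single call of one of the two broadcasting functions. -/
def callCost (n : ℕ) : ℕ :=
  n * pathCost n + n * (2 * n + 2) + n * (jobsCost n + 1) + (n * splitCost (n + 1) + 1) +
    jobsCost n + serveCost n + 6 * n + 12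

variable {V : Type}

/-- The amortisation: a fixed price `c` for each component, and `K` for each call of the job it
yields. -/
theorem sum_time_le_of_filterMap {α : Type} (f : α → Timed (Option (Job V))) (c K : ℕ)
    (l : List α)
    (h : ∀ a ∈ l, (f a).time ≤ c + K * jobsCalls (f a).ret.toList) :
    (l.map fun a => (f a).time).sum ≤
      l.length * c + K * jobsCalls (l.filterMap fun a => (f a).ret) := by
  induction l with
  | nil => simp
  | cons a l ih =>
      have h₁ := h a (by simp)
      have h₂ := ih fun b hb => h b (by simp [hb])
      cases hf : (f a).ret with
      | none =>
          simp only [hf, Option.toList_none, jobsCalls, List.map_nil, List.sum_nil] at h₁ h₂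
          simp only [List.map_cons, List.sum_cons, List.length_cons, List.filterMap_cons, hf,
            jobsCalls]
          linarith
      | some j =>
          simp only [hf, Option.toList_some, jobsCalls, List.map_cons, List.map_nil,
            List.sum_cons, List.sum_nil, Nat.add_zero] at h₁ h₂
          simp only [List.map_cons, List.sum_cons, List.length_cons, List.filterMap_cons, hf,
            jobsCalls]
          linarith

theorem exists_eq_cons_append_singleton {P l : List V} {a b : V} (h₁ : P = a :: l)
    (h₂ : P.getLast? = some b) (hab : a ≠ b) : ∃ l', P = a :: (l' ++ [b]) := by
  subst h₁
  rcases List.eq_nil_or_concat l with rfl | ⟨l', c, rfl⟩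
  · simp only [List.getLast?_singleton, Option.some.injEq] at h₂
    exact absurd h₂ hab
  · rw [List.concat_eq_append, ← List.cons_append, List.getLast?_concat, Option.some.injEq] at h₂
    exact ⟨l', by simp [h₂]⟩

variable [DecidableEq V] {G : SimpleGraph V}

/-- The computation `t` yields a solution for the subgraph on `U`, at a cost of at most `K` for each
call in it and one more. -/
structure Computes (G : SimpleGraph V) (K : ℕ) (U I : Set V) (t : Timed (Scheme V)) : Prop where
  solves : Solves G U I t.ret
  time_le : t.time ≤ K * (t.ret.flatten.length + 1)

/-- The broadcasting functions for subgraphs with at most `f` vertices are correct. -/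
structure Correct (G : SimpleGraph V) (K f : ℕ) (single : List V → V → Timed (Scheme V))
    (double : List V → V → V → Timed (Scheme V)) : Prop where
  single : ∀ U s, U.Nodup → U.length ≤ f → s ∈ U → ConnectedOn G U →
    Computes G K {x | x ∈ U} {s} (single U s)
  double : ∀ U s₁ s₂ x, U.Nodup → U.length ≤ f → s₁ ∈ U → s₂ ∈ U → s₁ ≠ s₂ → ConnectedOn G U →
    x ∉ U → G.Adj x s₁ → G.Adj x s₂ → Computes G K {x | x ∈ U} {s₁, s₂} (double U s₁ s₂)

theorem isJob_of_solves {s : V} {N D : List V} {S : Scheme V} (hN₁ : N ≠ []) (hN₂ : N.length ≤ 2)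
    (hN : N.Nodup) (hmem : ∀ v, v ∈ N ↔ v ∈ D ∧ G.Adj s v) (hs : s ∉ D)
    (hS : Solves G {x | x ∈ D} {v | v ∈ N} S) :
    IsJob G s (N.map fun v => (s, v), S) ∧
      jobVerts (N.map fun v => (s, v), S) = {x | x ∈ D} := by
  have hsnd : (N.map fun v => (s, v)).map Prod.snd = N := by simp [Function.comp_def]
  have hv : jobVerts (N.map fun v => (s, v), S) = {x | x ∈ D} := by
    ext v
    have h := hS.valid.mem_called_iff hS.subset v
    simp only [Set.mem_ofPred_eq] at h
    simp only [jobVerts, called_cons, hsnd, List.mem_append, Set.mem_ofPred_eq, h]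
    by_cases hvN : v ∈ N
    · simp [hvN, ((hmem v).1 hvN).1]
    · simp [hvN]
  refine ⟨⟨?_, by simpa using hN₁, by simpa using hN₂, fun v => ?_, ?_, ?_, ?_⟩, hv⟩
  · intro c hc
    obtain ⟨v, -, rfl⟩ := List.mem_map.1 hc
    rfl
  · rw [hv, hsnd]
    exact hmem v
  · rw [hsnd]
    exact hN
  · rw [hv, hsnd]
    exact hS
  · rw [hv]
    exact hs

variable {adj : V → V → Bool} {K f : ℕ} {single : List V → V → Timed (Scheme V)}
  {double : List V → V → V → Timed (Scheme V)}

/-- The recursive invocation costs `K` times one more than its number of calls, and an opening call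
of the job absorbs this excess. In the case of two neighbours, `s` itself is the outer vertex that
`Correct.double` requires. -/
theorem Correct.componentJobT_spec (h : Correct G K f single double) (hG : IsCactus G)
    (hadj : ∀ u v, adj u v = true ↔ G.Adj u v) {s : V} {D : List V} (hD : D.Nodup)
    (hf : D.length ≤ f) (hs : s ∉ D) (hc : ConnectedOn G D) :
    (componentJobT adj single double s D).time ≤
        2 * D.length + 2 + K * jobsCalls (componentJobT adj single double s D).ret.toList ∧
      ((∃ y ∈ D, G.Adj s y) → ∃ j, (componentJobT adj single double s D).ret = some j) ∧
      ∀ j, (componentJobT adj single double s D).ret = some j →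
        IsJob G s j ∧ jobVerts j = {x | x ∈ D} ∧ ∃ y ∈ D, G.Adj s y := by
  have hmem : ∀ v, v ∈ D.filter (fun a => adj s a) ↔ v ∈ D ∧ G.Adj s v := by
    intro v
    rw [List.mem_filter, hadj]
  have hnd := hD.filter (fun a => adj s a)
  have htime := partitionT_time_le (adjT adj s) 1 D fun _ _ => le_rfl
  simp only [componentJobT, Timed.bind_time, Timed.bind_ret, partitionT_ret, adjT_ret, tick_time]
  generalize D.filter (fun a => adj s a) = N at *
  match N with
  | [] =>
      simp only [Timed.pure_time, Timed.pure_ret, Option.toList_none, jobsCalls, List.map_nil,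
        List.sum_nil]
      refine ⟨by omega, fun ⟨y, hy, hsy⟩ => ?_, by simp⟩
      exact absurd ((hmem y).2 ⟨hy, hsy⟩) (by simp)
  | [v] =>
      have hv := (hmem v).1 (by simp)
      obtain ⟨h₁, h₂⟩ := h.single D v hD hf hv.1 hc
      simp only [Timed.bind_time, Timed.bind_ret, Timed.pure_time, Timed.pure_ret,
        Option.toList_some, jobsCalls, List.map_cons, List.map_nil, List.sum_cons, List.sum_nil,
        jobCalls, List.length_cons, List.length_nil]
      refine ⟨by nlinarith, fun _ => ⟨_, rfl⟩, fun j hj => ?_⟩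
      obtain ⟨h₃, h₄⟩ := isJob_of_solves (S := (single D v).ret) (by simp) (by simp) hnd hmem hs
        (by simpa using h₁)
      rw [← Option.some.inj hj]
      exact ⟨h₃, h₄, v, hv⟩
  | [v, u] =>
      have hv := (hmem v).1 (by simp)
      have hu := (hmem u).1 (by simp)
      have hvu : v ≠ u := by
        rintro rfl
        simp at hnd
      obtain ⟨h₁, h₂⟩ := h.double D v u s hD hf hv.1 hu.1 hvu hc hs hv.2 hu.2
      simp only [Timed.bind_time, Timed.bind_ret, Timed.pure_time, Timed.pure_ret,
        Option.toList_some, jobsCalls, List.map_cons, List.map_nil, List.sum_cons, List.sum_nil,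
        jobCalls, List.length_cons, List.length_nil]
      refine ⟨by nlinarith, fun _ => ⟨_, rfl⟩, fun j hj => ?_⟩
      have hset : ({v, u} : Set V) = {w | w ∈ [v, u]} := by
        ext w
        simp
      obtain ⟨h₃, h₄⟩ := isJob_of_solves (S := (double D v u).ret) (by simp) (by simp) hnd hmem hs
        (hset ▸ h₁)
      rw [← Option.some.inj hj]
      exact ⟨h₃, h₄, v, hv⟩
  | v :: u :: w :: N =>
      have hv := (hmem v).1 (by simp)
      have hu := (hmem u).1 (by simp)
      have hw := (hmem w).1 (by simp)
      simp only [List.nodup_cons, List.mem_cons, not_or] at hnd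
      exact absurd (hG.eq_of_adj hc hs hv.1 hu.1 hw.1 hv.2 hu.2 hw.2 hnd.1.1 hnd.1.2.1) hnd.2.1.1

/-- The jobs need not cover `R`: when `s` is on a path, other components hang on other path
vertices. Hence the description of the covered vertices by reachability from a neighbour of `s`. -/
theorem Correct.jobsT_spec (h : Correct G K f single double) (hG : IsCactus G)
    (hadj : ∀ u v, adj u v = true ↔ G.Adj u v) {s : V} {R : List V} (hR : R.Nodup)
    (hf : R.length ≤ f) (hs : s ∉ R) {n : ℕ} (hn : R.length ≤ n) :
    (AreJobs G s (jobsT adj single double R s).ret ∧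
      ∀ v, (∃ j ∈ (jobsT adj single double R s).ret, v ∈ jobVerts j) ↔
        v ∈ R ∧ ∃ y ∈ R, G.Adj s y ∧ (restrict G {x | x ∈ R}).Reachable y v) ∧
    (jobsT adj single double R s).time ≤
      jobsCost n + K * jobsCalls (jobsT adj single double R s).ret := by
  obtain ⟨hperm, hconn, hpair⟩ := componentsT_spec hadj R
  have hlen := componentsT_length_le hadj R
  have htime := componentsT_time_le hadj R hn
  simp only [jobsT, Timed.bind_ret, Timed.bind_time, tick_time, filterMapT_ret, filterMapT_time]
  generalize (componentsT adj R).ret = Ds at *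
  obtain ⟨hnd, hdisj⟩ := List.nodup_flatten.1 (hperm.nodup_iff.2 hR)
  have hsub : ∀ D ∈ Ds, ∀ v ∈ D, v ∈ R := fun D hD v hv =>
    hperm.subset (List.mem_flatten.2 ⟨D, hD, hv⟩)
  have hDlen : ∀ D ∈ Ds, D.length ≤ R.length := fun D hD =>
    (List.subperm_of_subset (hnd D hD) (hsub D hD)).length_le
  have hspec : ∀ D ∈ Ds, _ := fun D hD =>
    h.componentJobT_spec hG hadj (hnd D hD) ((hDlen D hD).trans hf)
      (fun hsD => hs (hsub D hD s hsD)) (hconn D hD).2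
  refine ⟨⟨⟨fun j hj => ?_, ?_⟩, fun v => ⟨?_, ?_⟩⟩, ?_⟩
  · obtain ⟨D, hD, hDj⟩ := List.mem_filterMap.1 hj
    exact ((hspec D hD).2.2 j hDj).1
  · rw [List.pairwise_filterMap]
    refine (List.Pairwise.and_mem.1 (hpair.and hdisj)).imp ?_
    rintro D D' ⟨hD, hD', hsep, hdis⟩ j hj j' hj'
    rw [((hspec D hD).2.2 j hj).2.1, ((hspec D' hD').2.2 j' hj').2.1]
    exact fun x hx y hy => ⟨fun hxy => hdis hx (hxy ▸ hy), hsep x hx y hy⟩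
  · rintro ⟨j, hj, hv⟩
    obtain ⟨D, hD, hDj⟩ := List.mem_filterMap.1 hj
    obtain ⟨-, hverts, y, hy, hsy⟩ := (hspec D hD).2.2 j hDj
    rw [hverts] at hv
    exact ⟨hsub D hD v hv, y, hsub D hD y hy, hsy,
      ((hconn D hD).2 y hy v hv).mono (restrict_mono (hsub D hD))⟩
  · rintro ⟨hv, y, hy, hsy, hyv⟩
    obtain ⟨D, hD, hyD⟩ := List.mem_flatten.1 (hperm.symm.subset hy)
    -- No edge leaves a component inside `R`, so `v` is in the same component as `y`.
    have hvD : v ∈ {x | x ∈ D} := by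
      refine mem_of_reachable (fun x hx z hxz => ?_) hyD hyv
      obtain ⟨D', hD', hzD'⟩ := List.mem_flatten.1 (hperm.symm.subset hxz.2.2)
      by_cases hDD : D = D'
      · rw [hDD]
        exact hzD'
      · have : Std.Symm fun D D' : List V => ∀ x ∈ D, ∀ y ∈ D', ¬ G.Adj x y :=
          ⟨fun _ _ h x hx y hy hxy => h y hy x hx hxy.symm⟩
        exact absurd hxz.1 (hpair.forall hD hD' hDD x hx z hzD')
    obtain ⟨j, hj⟩ := (hspec D hD).2.1 ⟨y, hyD, hsy⟩
    refine ⟨j, List.mem_filterMap.2 ⟨D, hD, hj⟩, ?_⟩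
    rw [((hspec D hD).2.2 j hj).2.1]
    exact hvD
  · have hsum := sum_time_le_of_filterMap (componentJobT adj single double s) (2 * n + 2) K Ds
      fun D hD => (hspec D hD).1.trans (by have := hDlen D hD; omega)
    have : Ds.length * (2 * n + 2) ≤ n * (2 * n + 2) := by
      gcongr
      omega
    unfold jobsCost
    omega

variable [Fintype V]

/-- Connectedness of `U` ensures that each component left after the deletion of `s` contains a
neighbour of `s`, so that the jobs cover `U`. -/
theorem singleSourceT_computes (hG : IsCactus G) (hadj : ∀ u v, adj u v = true ↔ G.Adj u v)
    (h : Correct G (callCost (Fintype.card V)) f (singleSourceT adj f) (doubleSourceT adj f))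
    {U : List V} {s : V} (hU : U.Nodup) (hf : U.length ≤ f + 1) (hs : s ∈ U)
    (hc : ConnectedOn G U) :
    Computes G (callCost (Fintype.card V)) {x | x ∈ U} {s} (singleSourceT adj (f + 1) U s) := by
  have hn : U.length ≤ Fintype.card V := hU.length_le_card
  have hlen : (U.filter fun v => v ∉ [s]).length < U.length :=
    List.length_filter_lt_length_iff_exists.2 ⟨s, hs, by simp⟩
  have hdiff := diffT_time_le U [s]
  obtain ⟨⟨hj, hv⟩, ht⟩ := h.jobsT_spec hG hadj (s := s) (hU.filter fun v => v ∉ [s])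
    (by omega) (by simp) (n := Fintype.card V) (by omega)
  have hset : armVerts (s, (jobsT adj (singleSourceT adj f) (doubleSourceT adj f)
      (U.filter fun v => v ∉ [s]) s).ret) = {x | x ∈ U} := by
    ext v
    rw [armVerts, Set.mem_ofPred_eq, hv, mem_filter_notMem_singleton]
    constructor
    · rintro (rfl | hv)
      exacts [hs, hv.1.1]
    · intro hvU
      by_cases hvs : v = s
      · exact Or.inl hvs
      · refine Or.inr ⟨⟨hvU, hvs⟩, ?_⟩
        obtain ⟨p, hp, y, hy, hpy, hyv⟩ := hc.exists_attached (P := [s]) (p₀ := s)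
          (R := U.filter fun v => v ∉ [s]) (v := v) (fun x => by simp) (by simp) hs
          (mem_filter_notMem_singleton.2 ⟨hvU, hvs⟩)
        rw [List.mem_singleton.1 hp] at hpy
        exact ⟨y, hy, hpy, hyv⟩
  have hsol := hj.solves_serveT
  have hcalls := hsol.flatten_length_le
  have hserve := hj.serveT_time_le (n := Fintype.card V) (by
    rwa [serveT_flatten_length] at hcalls)
  rw [hset] at hsol
  constructor
  · simpa [singleSourceT] using hsol
  · simp only [singleSourceT, Timed.bind_time, Timed.bind_ret, tick_time, diffT_ret,
      serveT_flatten_length, List.length_singleton] at hdiff ⊢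
    have : jobsCost (Fintype.card V) + serveCost (Fintype.card V) + 6 * Fintype.card V + 12 ≤
      callCost (Fintype.card V) := by
      unfold callCost
      omega
    rw [Nat.mul_add, Nat.mul_one]
    omega

/-- The outer vertex `x` replaces the assumption on cut-edges: it closes any path from `s₁` to `s₂`
in `U` to a cycle. -/
theorem doubleSourceT_computes (hG : IsCactus G) (hadj : ∀ u v, adj u v = true ↔ G.Adj u v)
    (h : Correct G (callCost (Fintype.card V)) f (singleSourceT adj f) (doubleSourceT adj f))
    {U : List V} {s₁ s₂ x : V} (hU : U.Nodup) (hf : U.length ≤ f + 1) (hs₁ : s₁ ∈ U)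
    (hs₂ : s₂ ∈ U) (hne : s₁ ≠ s₂) (hc : ConnectedOn G U) (hx : x ∉ U) (hx₁ : G.Adj x s₁)
    (hx₂ : G.Adj x s₂) :
    Computes G (callCost (Fintype.card V)) {x | x ∈ U} {s₁, s₂}
      (doubleSourceT adj (f + 1) U s₁ s₂) := by
  have hn : U.length ≤ Fintype.card V := hU.length_le_card
  have hAlen : (U.filter fun v => v ∉ [s₁]).length < U.length :=
    List.length_filter_lt_length_iff_exists.2 ⟨s₁, hs₁, by simp⟩
  have hmemA : ∀ y, y ∈ U ↔ y ∈ s₁ :: U.filter fun v => v ∉ [s₁] := by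
    intro y
    rw [List.mem_cons, mem_filter_notMem_singleton]
    by_cases hy : y = s₁
    · simp [hy, hs₁]
    · simp [hy]
  have hdiff₁ := diffT_time_le U [s₁]
  have hpt := pathT_time_le hadj U.length s₁ s₂ (U.filter fun v => v ∉ [s₁])
    (m := Fintype.card V) (by omega)
  obtain ⟨⟨l, hl⟩, hlast, hchain, hnd, hPU⟩ := pathT_spec hadj U.length s₁ s₂
    (U.filter fun v => v ∉ [s₁]) (by omega) (hU.filter _) (by simp) ((hmemA s₂).1 hs₂)
    (hc.congr hmemA)
  suffices hgoal : Solves G {x | x ∈ U} {s₁, s₂} (doubleSourceT adj (f + 1) U s₁ s₂).ret ∧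
      (doubleSourceT adj (f + 1) U s₁ s₂).time ≤ callCost (Fintype.card V) *
        ((doubleSourceT adj (f + 1) U s₁ s₂).ret.flatten.length + 1) from ⟨hgoal.1, hgoal.2⟩
  simp only [doubleSourceT, Timed.bind_ret, Timed.bind_time, lengthT_ret, lengthT_time, tick_time,
    diffT_ret, mapT_ret, mapT_time, Timed.pure_ret, Timed.pure_time]
  have hPU' : ∀ y ∈ (pathT adj U.length s₁ s₂ (U.filter fun v => v ∉ [s₁])).ret, y ∈ U :=
    fun y hy => (hmemA y).2 (hPU y hy)
  have hhead : (pathT adj U.length s₁ s₂ (U.filter fun v => v ∉ [s₁])).ret.head? = some s₁ := by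
    rw [hl, List.head?_cons]
  have hPn := hnd.length_le_card
  have hdiff₂ := diffT_time_le U (pathT adj U.length s₁ s₂ (U.filter fun v => v ∉ [s₁])).ret
  obtain ⟨l', hl'⟩ := exists_eq_cons_append_singleton hl hlast hne
  clear hl hPU
  generalize hPdef : (pathT adj U.length s₁ s₂ (U.filter fun v => v ∉ [s₁])).ret = P at *
  have hR : ∀ y, y ∈ U.filter (fun v => v ∉ P) ↔ y ∈ U ∧ y ∉ P := fun y => by simp
  have hRlen : (U.filter fun v => v ∉ P).length < U.length :=
    List.length_filter_lt_length_iff_exists.2 ⟨s₁, hs₁, by simp [hl']⟩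
  have hjobs := fun p (hp : p ∈ P) => h.jobsT_spec hG hadj (s := p)
    (hU.filter fun v => v ∉ P) (by omega) (fun hpR => ((hR p).1 hpR).2 hp)
    (n := Fintype.card V) (by omega)
  generalize hjsdef : (fun p => jobsT adj (singleSourceT adj f) (doubleSourceT adj f)
    (U.filter fun v => v ∉ P) p) = js
  have hjs : ∀ p, jobsT adj (singleSourceT adj f) (doubleSourceT adj f)
    (U.filter fun v => v ∉ P) p = js p := fun p => congrFun hjsdef p
  simp only [hjs] at hjobs ⊢
  have harms := hG.isArms hx hx₁ hx₂ hne hPU' hchain hnd hhead hlast hR (fun p => (js p).ret)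
    fun p hp => (hjobs p hp).1
  have hverts : armsVerts (P.map fun p => (p, (js p).ret)) = {y | y ∈ U} := by
    ext v
    constructor
    · rintro ⟨a, ha, hva⟩
      obtain ⟨p, hp, rfl⟩ := List.mem_map.1 ha
      rcases hva with rfl | hva
      · exact hPU' _ hp
      · exact ((hR v).1 (((hjobs p hp).1.2 v).1 hva).1).1
    · intro hv
      by_cases hvP : v ∈ P
      · exact ⟨_, List.mem_map_of_mem hvP, Or.inl rfl⟩
      · have hvR := (hR v).2 ⟨hv, hvP⟩
        obtain ⟨p, hp, y, hy, hpy, hyv⟩ := hc.exists_attached (p₀ := s₁) hR (by simp [hl']) hs₁ hvR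
        exact ⟨_, List.mem_map_of_mem hp, Or.inr (((hjobs p hp).1.2 v).2 ⟨hvR, y, hy, hpy, hyv⟩)⟩
  have hmap : P.map (fun p => (p, (js p).ret)) =
      (s₁, (js s₁).ret) :: (l'.map (fun p => (p, (js p).ret)) ++ [(s₂, (js s₂).ret)]) := by
    simp [hl']
  -- The summands have the shape of the unfolded loop body: one tick, the jobs, and a free return.
  have hsum : (P.map fun p => 1 + ((js p).time + 0)).sum ≤
      P.length * (jobsCost (Fintype.card V) + 1) +
      callCost (Fintype.card V) * armsCalls (P.map fun p => (p, (js p).ret)) := by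
    have : ∀ p ∈ P, 1 + ((js p).time + 0) ≤ (jobsCost (Fintype.card V) + 1) +
        callCost (Fintype.card V) * jobsCalls (js p).ret := fun p hp => by
      have := (hjobs p hp).2
      omega
    refine (List.sum_le_sum this).trans ?_
    rw [List.sum_map_add, List.sum_map_mul_left, List.map_const', List.sum_replicate, smul_eq_mul,
      armsCalls, List.map_map]
    rfl
  rw [hmap] at harms hverts hsum ⊢
  obtain ⟨S, hS, hsol, hcalls⟩ := harms.solves_bestSplitT
  rw [hverts] at hsol
  have hle := hsol.flatten_length_le
  -- By `hcalls`, path vertices and job calls together exceed the number of calls, at most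
  -- `Fintype.card V`, by 2. As `bestSplitT_time_le` allows an excess of 1, its parameter is
  -- `Fintype.card V + 1`; this explains `splitCost (n + 1)` in `callCost`.
  have hbt := bestSplitT_time_le [(s₁, (js s₁).ret)]
    (l'.map (fun p => (p, (js p).ret)) ++ [(s₂, (js s₂).ret)]) (n := Fintype.card V + 1)
    (by simpa using harms) (by simp) (by
      simp only [List.reverse_singleton, List.singleton_append]
      omega)
  have hPlen : P.length = l'.length + 2 := by simp [hl']
  simp only [Timed.bind_ret, Timed.bind_time, hS, Timed.pure_ret, Timed.pure_time]
  refine ⟨hsol, ?_⟩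
  simp only [List.length_append, List.length_map, List.length_cons, List.length_nil,
    Nat.zero_add] at hbt hcalls hdiff₁ ⊢
  have e₁ : U.length * pathCost (Fintype.card V) ≤ Fintype.card V * pathCost (Fintype.card V) := by
    gcongr
  have e₂ : U.length * (2 * P.length + 2) ≤ Fintype.card V * (2 * Fintype.card V + 2) := by
    gcongr
  have e₃ : P.length * (jobsCost (Fintype.card V) + 1) ≤
      Fintype.card V * (jobsCost (Fintype.card V) + 1) := by
    gcongr
  have e₄ : (l'.length + 1) * splitCost (Fintype.card V + 1) ≤
      Fintype.card V * splitCost (Fintype.card V + 1) := by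
    gcongr
    omega
  have e₅ : S.flatten.length = armsCalls ((s₁, (js s₁).ret) ::
      (l'.map (fun p => (p, (js p).ret)) ++ [(s₂, (js s₂).ret)])) + l'.length := by
    omega
  -- The calls inside the jobs pay for the recursion, and one further `callCost` pays for all the
  -- work of this invocation.
  have e₆ : callCost (Fintype.card V) * (armsCalls ((s₁, (js s₁).ret) ::
      (l'.map (fun p => (p, (js p).ret)) ++ [(s₂, (js s₂).ret)])) + 1) ≤
      callCost (Fintype.card V) * (S.flatten.length + 1) := by
    gcongr
    omega
  refine le_trans ?_ e₆
  rw [Nat.mul_add, Nat.mul_one]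
  have e₇ : callCost (Fintype.card V) = Fintype.card V * pathCost (Fintype.card V) +
    Fintype.card V * (2 * Fintype.card V + 2) + Fintype.card V * (jobsCost (Fintype.card V) + 1) +
    (Fintype.card V * splitCost (Fintype.card V + 1) + 1) + jobsCost (Fintype.card V) +
    serveCost (Fintype.card V) + 6 * Fintype.card V + 12 := rfl
  omega

/-- Joint induction on the fuel. Each invocation removes at least one source before it recurs;
without fuel the claims are vacuous, since an empty list contains no source. -/
theorem correct_broadcasters (hG : IsCactus G) (hadj : ∀ u v, adj u v = true ↔ G.Adj u v)
    (f : ℕ) :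
    Correct G (callCost (Fintype.card V)) f (singleSourceT adj f) (doubleSourceT adj f) := by
  induction f with
  | zero =>
      constructor
      · intro U s _ hf hs
        rw [List.length_eq_zero_iff.1 (Nat.le_zero.1 hf)] at hs
        exact absurd hs (by simp)
      · intro U s _ _ _ hf hs
        rw [List.length_eq_zero_iff.1 (Nat.le_zero.1 hf)] at hs
        exact absurd hs (by simp)
  | succ f ih =>
      exact ⟨fun U s hU hf hs hc => singleSourceT_computes hG hadj ih hU hf hs hc,
        fun U s₁ s₂ x hU hf hs₁ hs₂ hne hc hx hx₁ hx₂ =>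
          doubleSourceT_computes hG hadj ih hU hf hs₁ hs₂ hne hc hx hx₁ hx₂⟩

end Broadcaster

-- The whole graph: comparison with the optimum, and the polynomial bound

section Main

variable {n : ℕ} {G : SimpleGraph (Fin n)} [DecidableRel G.Adj]

theorem superScheme_computes (hG : IsCactus G) (s : Fin n) :
    Solves G Set.univ {s} (superScheme G s).ret ∧
      (superScheme G s).time ≤ callCost n * (n + 1) + 1 := by
  have huniv : {x | x ∈ List.finRange n} = Set.univ := by
    ext x
    simp
  have hc : ConnectedOn G (List.finRange n) := by
    intro a _ b _
    refine (hG.1.preconnected a b).mono fun x y hxy => ⟨hxy, ?_, ?_⟩ <;> simp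
  obtain ⟨h₁, h₂⟩ := (correct_broadcasters hG (adj := fun u v => decide (G.Adj u v))
    (fun u v => by simp) n).single (List.finRange n) s (List.nodup_finRange n) (by simp)
    (List.mem_finRange s) hc
  have h₃ := h₁.flatten_length_le
  rw [huniv] at h₁
  rw [Fintype.card_fin] at h₂ h₃
  refine ⟨h₁, ?_⟩
  have h₄ : callCost n * ((singleSourceT (fun u v => decide (G.Adj u v)) n (List.finRange n)
      s).ret.flatten.length + 1) ≤ callCost n * (n + 1) := by gcongr
  simp only [superScheme, Timed.bind_time, tick_time]
  omega

theorem superScheme_length_le (hG : IsCactus G) (s : Fin n) :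
    (superScheme G s).ret.length ≤ broadcastTime 1 G s := by
  have h := (superScheme_computes hG s).1
  -- The infimum is attained because the set is not empty: converting the computed scheme gives a
  -- classic one.
  obtain ⟨S, hS, hlen⟩ : broadcastTime 1 G s ∈
      {t | ∃ S : Scheme (Fin n), IsBroadcast 1 G {s} S ∧ S.length = t} :=
    Nat.sInf_mem ⟨_, _, h.valid.isBroadcast.toClassicT, rfl⟩
  rw [← hlen]
  exact h.length_le_of_feasible _ hS.feasible

/-- A bound for the cost of Cactus Broadcaster. -/
def totalCost (n : ℕ) : ℕ :=
  callCost n * (n + 1) + (n * (2 * (n * (2 * n + 2) + 3) + 3) + 1) + 2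

theorem cactusBroadcaster_time_le (hG : IsCactus G) (s : Fin n) :
    (cactusBroadcaster G s).time ≤ totalCost n := by
  obtain ⟨h₁, h₂⟩ := superScheme_computes hG s
  have h₃ := h₁.flatten_length_le
  rw [Fintype.card_fin] at h₃
  have h₄ := toClassicT_time_le 2 (superScheme G s).ret (n := n) fun R hR =>
    ((List.sublist_flatten_of_mem hR).length_le).trans h₃
  have h₅ : (superScheme G s).ret.length * (2 * (n * (2 * n + 2) + 3) + 3) ≤
      n * (2 * (n * (2 * n + 2) + 3) + 3) := by
    gcongr
    exact h₁.length_le.trans h₃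
  simp only [cactusBroadcaster, Timed.bind_time, tick_time, totalCost]
  omega

/-- The function is given by a polynomial. -/
def IsPolynomial (f : ℕ → ℕ) : Prop := ∃ p : Polynomial ℕ, ∀ n, p.eval n = f n

theorem isPolynomial_const (c : ℕ) : IsPolynomial fun _ => c := ⟨Polynomial.C c, by simp⟩

theorem isPolynomial_id : IsPolynomial fun n => n := ⟨Polynomial.X, by simp⟩

theorem IsPolynomial.add {f g : ℕ → ℕ} (hf : IsPolynomial f) (hg : IsPolynomial g) :
    IsPolynomial fun n => f n + g n := by
  obtain ⟨p, hp⟩ := hf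
  obtain ⟨q, hq⟩ := hg
  exact ⟨p + q, fun n => by simp [hp, hq]⟩

theorem IsPolynomial.mul {f g : ℕ → ℕ} (hf : IsPolynomial f) (hg : IsPolynomial g) :
    IsPolynomial fun n => f n * g n := by
  obtain ⟨p, hp⟩ := hf
  obtain ⟨q, hq⟩ := hg
  exact ⟨p * q, fun n => by simp [hp, hq]⟩

theorem isPolynomial_totalCost : IsPolynomial totalCost := by
  unfold totalCost callCost jobsCost splitCost serveCost pathCost componentsCost componentCost
  repeat' first
    | exact isPolynomial_const _
    | exact isPolynomial_id
    | apply IsPolynomial.add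
    | apply IsPolynomial.mul

end Main

end Telephone

theorem mainTheorem2 :
    -- Cactus Broadcaster runs in polynomial time
    (∃ p : Polynomial ℕ, ∀ (n : ℕ) (G : SimpleGraph (Fin n)) [DecidableRel G.Adj] (s : Fin n),
      Telephone.IsCactus G → (Telephone.cactusBroadcaster G s).time ≤ p.eval n) ∧
    -- it returns a valid classic scheme with at most twice the optimal number of rounds
    (∀ (n : ℕ) (G : SimpleGraph (Fin n)) [DecidableRel G.Adj] (s : Fin n),
      Telephone.IsCactus G →
        Telephone.IsBroadcast 1 G {s} (Telephone.cactusBroadcaster G s).ret ∧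
        (Telephone.cactusBroadcaster G s).ret.length ≤ 2 * Telephone.broadcastTime 1 G s) ∧
    -- its scheme in the multi-broadcasting model is valid, with at most the classic optimum of rounds
    (∀ (n : ℕ) (G : SimpleGraph (Fin n)) [DecidableRel G.Adj] (s : Fin n),
      Telephone.IsCactus G →
        Telephone.IsBroadcast 2 G {s} (Telephone.superScheme G s).ret ∧
        (Telephone.superScheme G s).ret.length ≤ Telephone.broadcastTime 1 G s) ∧
    -- the conversion from the multi-broadcasting model to the classic one, on arbitrary graphs
    (∀ (n : ℕ) (G : SimpleGraph (Fin n)) (s : Fin n) (k : ℕ) (S : Telephone.Scheme (Fin n)),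
      Telephone.IsBroadcast k G {s} S →
        Telephone.IsBroadcast 1 G {s} (Telephone.toClassicT k S).ret ∧
        (Telephone.toClassicT k S).ret.length ≤ k * S.length) := by
  refine ⟨?_, fun n G _ s hG => ?_, fun n G _ s hG => ?_, fun n G s k S hS => ?_⟩
  · obtain ⟨p, hp⟩ := Telephone.isPolynomial_totalCost
    exact ⟨p, fun n G _ s hG => (hp n).symm ▸ Telephone.cactusBroadcaster_time_le hG s⟩
  · refine ⟨(Telephone.superScheme_computes hG s).1.valid.isBroadcast.toClassicT, ?_⟩
    -- The factor 2 arises only here, from replacing each round by two.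
    refine (Telephone.toClassicT_length 2 (Telephone.superScheme G s).ret).le.trans ?_
    exact Nat.mul_le_mul_left 2 (Telephone.superScheme_length_le hG s)
  · exact ⟨(Telephone.superScheme_computes hG s).1.valid.isBroadcast,
      Telephone.superScheme_length_le hG s⟩
  · exact ⟨hS.toClassicT, (Telephone.toClassicT_length k S).le⟩
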